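/- Let $k$ be a field of characteristic $2$. **Conventions.** For an algebra endomorphism $\tau$ of a $k$-algebra $A$ and a $\tau$-derivation $\delta$ (that is, $\delta$ is $k$-linear and $\delta(ab)=\tau(a)\delta(b)+\delta(a)b$), the Ore extension $A[z;\tau,\delta]$ is the algebra generated by $A$ and $z$ with the relations $za=\tau(a)z+\delta(a)$, $a\in A$. If $A$ is a Hopf algebra, a *generalized Hopf-Ore extension* of $A$, determined by $(r_1,r_2,x,y)\in A^4$, is a Hopf algebra structure on an Ore extension $H=A[z;\tau,\delta]$ such that $A$ is a Hopf subalgebra and $\Delta z=z\otimes r_1+x\otimes y+r_2\otimes z$. It is *normalized* if $r_1,r_2$ are group-like, $\Delta x=x\otimes 1+r_2\otimes x$, $\Delta y=y\otimes r_1+1\otimes y$, and $x=0$ if and only if $y=0$. A normalized one with $\tau(a)=\sum\chi(a_1)r_1a_2r_1^{-1}$ for an algebra map $\chi:A\to k$ is denoted by $A(\chi,r_1,r_2,x,y,\delta)$. Two generalized Hopf-Ore extensions $H$ of $A$ and $H'$ of $A'$ are isomorphic if there is a Hopf algebra isomorphism $H\to H'$ taking $A$ onto $A'$. For a Lie algebra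 $\mathfrak g$ over $k$, $U(\mathfrak g)$ carries the Hopf algebra structure in which the elements of $\mathfrak g$ are primitive, and $\hat{\mathfrak g}\subseteq U(\mathfrak g)$ is the span of all $u^{2^r}$, $u\in\mathfrak g$, $r\ge 0$. In $U(\mathfrak g)$ we write $[u,v]=uv-vu$. A character of $U(\mathfrak g)$ that vanishes on $\mathfrak g$ is written $\chi=0$. **Proposition.** Let $\mathfrak g$ be a $2$-dimensional Lie algebra over $k$. 1. If a generalized Hopf-Ore extension of $U(\mathfrak g)$ is determined by $(r_1,r_2,x,y)$, then $r_1=r_2=1$; if it is normalized, then $x,y\in\hat{\mathfrak g}$. 2. $\mathfrak g$ has a basis $\{a,b\}$ with $[a,b]=0$ or $[a,b]=a$. For every such basis, every generalized Hopf-Ore extension of $U(\mathfrak g)$ is isomorphic to a generalized Hopf-Ore extension of $U(\mathfrak g)$ in one of the following families. In (c) and (d), write $x=\sum_i\alpha_i a^{2^i}+\sum_i\alpha_i' b^{2^i}$, $y=\sum_i\beta_i a^{2^i}+\sum_i\beta'_i b^{2^i}$ (finite sums, coefficients in $k$) and $\alpha'=\sum_i\alpha'_i$, $\beta'=\sum_i\beta'_i$.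 (a) $U(\mathfrak g)(\chi,1,1,0,0,\delta)$ with $[a,b]=0$ or $[a,b]=a$, $\delta(\mathfrak g)\subseteq\hat{\mathfrak g}$ and $\delta([a,b])=[\delta(a),b]+[a,\delta(b)]+\chi(a)\delta(b)-\chi(b)\delta(a)$. (b) $U(\mathfrak g)(0,1,1,x,y,\delta)$ with $[a,b]=0$, $x,y\in\hat{\mathfrak g}\setminus\{0\}$ and $\delta(\mathfrak g)\subseteq\hat{\mathfrak g}$. (c) $U(\mathfrak g)(0,1,1,x,y,\delta)$ with $[a,b]=a$, $x,y\in\hat{\mathfrak g}\setminus\{0\}$, $\alpha_0y=\beta_0x$, $\alpha'y=\beta'x$, $\delta(a)=[\delta(a),b]+[a,\delta(b)]$, and either (i) $x=\alpha_0a$ (hence $y=\beta_0a$) and $\delta(\mathfrak g)\subseteq\hat{\mathfrak g}$, or (ii) $x\ne\alpha_0a$ and $\delta(a)-\beta'ax\in\hat{\mathfrak g}$, $\delta(b)-\beta_0ax\in\hat{\mathfrak g}$. (d) $U(\mathfrak g)(\chi,1,1,x,y,\delta)$ with $[a,b]=a$, $\chi(a)=0$, $\chi(b)=1$, $x,y\in\hat{\mathfrak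 g}\setminus\{0\}$, $\delta(\mathfrak g)\subseteq\hat{\mathfrak g}$, $[\delta(a),b]+[a,\delta(b)]=0$, and either (i) $x=\alpha_0a$ and $\beta_0=\beta'=0$, or (ii) $\alpha_0=\alpha'=0$ and $y=\beta_0a$. 3. The members of family (a) with $\delta(\mathfrak g)\subseteq\mathfrak g$ are exactly the enveloping algebras of the $3$-dimensional Lie algebras containing $\mathfrak g$: for each such member $H$ there are a $3$-dimensional Lie algebra $L$, an injective Lie algebra map $j:\mathfrak g\to L$ and a Hopf algebra isomorphism $H\to U(L)$ that restricts to $j$ on $\mathfrak g$; and conversely, for every injective Lie algebra map $j:\mathfrak g\to L$ with $\dim L=3$ there is such a member $H$ with such an isomorphism $H\to U(L)$. -/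

import Mathlib

open scoped TensorProduct

universe u v w t

noncomputable section

/-! ### The Hopf algebra structure on a universal enveloping algebra -/

namespace UEAHopf

attribute [local instance 100] LieRing.ofAssociativeRing

variable (k : Type u) [CommRing k] (g : Type v) [LieRing g] [LieAlgebra k g]

local notation "U" => UniversalEnvelopingAlgebra k g
local notation "ιU" => UniversalEnvelopingAlgebra.ι k

/-- The comultiplication of `U(g)`: the algebra map with `u ↦ u ⊗ 1 + 1 ⊗ u` for `u` in `g`. -/
def comulHom : U →ₐ[k] U ⊗[k] U :=
  UniversalEnvelopingAlgebra.lift k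
    { toFun := fun u => (ιU u : U) ⊗ₜ[k] (1 : U) + (1 : U) ⊗ₜ[k] (ιU u : U)
      map_add' := by
        intro x y
        simp only [map_add, TensorProduct.add_tmul, TensorProduct.tmul_add]
        abel
      map_smul' := by
        intro c x
        simp [TensorProduct.smul_tmul']
      map_lie' := by
        intro x y
        simp only [LieHom.map_lie, LieRing.of_associative_ring_bracket, TensorProduct.sub_tmul,
          TensorProduct.tmul_sub, mul_add, add_mul, Algebra.TensorProduct.tmul_mul_tmul,
          mul_one, one_mul]
        abel }

/-- The counit of `U(g)`: the algebra map that vanishes on `g`. -/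
def counitHom : U →ₐ[k] k :=
  UniversalEnvelopingAlgebra.lift k
    { toFun := fun _ => 0
      map_add' := by simp
      map_smul' := by simp
      map_lie' := by simp }

/-- The antipode of `U(g)`, as an algebra map to the opposite algebra, with `u ↦ -u` on `g`. -/
def antipodeHom : U →ₐ[k] (U)ᵐᵒᵖ :=
  UniversalEnvelopingAlgebra.lift k
    { toFun := fun u => MulOpposite.op (-(ιU u : U))
      map_add' := by
        intro x y
        apply MulOpposite.unop_injective
        simp only [map_add, MulOpposite.unop_op, MulOpposite.unop_add]
        abel
      map_smul' := by
        intro c x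
        apply MulOpposite.unop_injective
        simp
      map_lie' := by
        intro x y
        apply MulOpposite.unop_injective
        simp [LieRing.of_associative_ring_bracket] }

variable {k g}

@[simp] theorem comulHom_ι (u : g) :
    comulHom k g (ιU u) = (ιU u : U) ⊗ₜ[k] (1 : U) + (1 : U) ⊗ₜ[k] (ιU u : U) :=
  UniversalEnvelopingAlgebra.lift_ι_apply _ _ _

@[simp] theorem counitHom_ι (u : g) : counitHom k g (ιU u) = 0 :=
  UniversalEnvelopingAlgebra.lift_ι_apply _ _ _

@[simp] theorem antipodeHom_ι (u : g) :
    antipodeHom k g (ιU u) = MulOpposite.op (-(ιU u : U)) :=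
  UniversalEnvelopingAlgebra.lift_ι_apply _ _ _

theorem mem_of_forall_ι (B : Subalgebra k U) (h : ∀ u : g, (ιU u : U) ∈ B) (w : U) : w ∈ B := by
  let f : g →ₗ⁅k⁆ B :=
    { toFun := fun u => ⟨ιU u, h u⟩
      map_add' := by intro x y; ext; simp
      map_smul' := by intro c x; ext; simp
      map_lie' := by
        intro x y
        apply Subtype.ext
        simp [LieRing.of_associative_ring_bracket] }
  have : B.val.comp (UniversalEnvelopingAlgebra.lift k f) = AlgHom.id k U := by
    apply UniversalEnvelopingAlgebra.hom_ext
    ext u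
    have := UniversalEnvelopingAlgebra.lift_ι_apply k f u
    change ((UniversalEnvelopingAlgebra.lift k f (ιU u) : B) : U) = ιU u
    rw [this]
    rfl
  have h2 := DFunLike.congr_fun this w
  rw [← show B.val (UniversalEnvelopingAlgebra.lift k f w) = w from h2]
  exact (UniversalEnvelopingAlgebra.lift k f w).2

theorem algHom_ext {A : Type*} [Ring A] [Algebra k A] {F G : U →ₐ[k] A}
    (h : ∀ u : g, F (ιU u) = G (ιU u)) : F = G :=
  UniversalEnvelopingAlgebra.hom_ext k (LieHom.ext h)

instance instBialgebra : Bialgebra k U :=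
  Bialgebra.ofAlgHom (comulHom k g) (counitHom k g)
    (by
      apply algHom_ext
      intro u
      simp [-UniversalEnvelopingAlgebra.ι_apply, TensorProduct.add_tmul, TensorProduct.tmul_add,
        Algebra.TensorProduct.one_def, add_assoc])
    (by
      apply algHom_ext
      intro u
      simp [-UniversalEnvelopingAlgebra.ι_apply])
    (by
      apply algHom_ext
      intro u
      simp [-UniversalEnvelopingAlgebra.ι_apply])

theorem comul_eq (w : U) : Coalgebra.comul (R := k) w = comulHom k g w := rfl
theorem counit_eq (w : U) : Coalgebra.counit (R := k) w = counitHom k g w := rfl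

/-- The antipode of `U(g)` as a linear map. -/
def antipodeLin : U →ₗ[k] U :=
  (MulOpposite.opLinearEquiv k).symm.toLinearMap ∘ₗ (antipodeHom k g).toLinearMap

theorem antipodeLin_mul (p q : U) :
    antipodeLin (p * q) = antipodeLin q * antipodeLin (k := k) (g := g) p := by
  simp [antipodeLin]

theorem antipodeLin_ι (u : g) : antipodeLin (ιU u) = -(ιU u : U) := by
  simp only [antipodeLin, LinearMap.comp_apply, AlgHom.toLinearMap_apply, antipodeHom_ι]
  rfl

theorem antipodeLin_one : antipodeLin (1 : U) = 1 := by
  simp [antipodeLin]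

theorem antipode_left (w : U) (s : U ⊗[k] U) :
    LinearMap.mul' k U (antipodeLin.rTensor U (comulHom k g w * s)) =
      counitHom k g w • LinearMap.mul' k U (antipodeLin.rTensor U s) := by
  let B : Subalgebra k U :=
    { carrier := {w | ∀ s : U ⊗[k] U,
        LinearMap.mul' k U (antipodeLin.rTensor U (comulHom k g w * s)) =
          counitHom k g w • LinearMap.mul' k U (antipodeLin.rTensor U s)}
      mul_mem' := by
        intro a b ha hb s
        simp only [Set.mem_ofPred_eq] at ha hb
        rw [map_mul (comulHom k g), mul_assoc, ha, hb, map_mul (counitHom k g), mul_smul]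
      add_mem' := by
        intro a b ha hb s
        simp only [Set.mem_ofPred_eq] at ha hb
        rw [map_add, add_mul, map_add, map_add, ha, hb, map_add, add_smul]
      algebraMap_mem' := by
        intro c s
        rw [AlgHom.commutes, AlgHom.commutes, ← Algebra.smul_def, map_smul, map_smul]
        rfl }
  refine mem_of_forall_ι B (fun u => ?_) w s
  intro s
  rw [comulHom_ι, counitHom_ι, zero_smul]
  induction s using TensorProduct.induction_on with
  | zero => simp
  | add p q hp hq => rw [mul_add, map_add, map_add, hp, hq, add_zero]
  | tmul p q =>
    simp [-UniversalEnvelopingAlgebra.ι_apply, add_mul, antipodeLin_mul, antipodeLin_ι, mul_assoc]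

theorem antipode_right (w : U) (s : U ⊗[k] U) :
    LinearMap.mul' k U (antipodeLin.lTensor U (s * comulHom k g w)) =
      counitHom k g w • LinearMap.mul' k U (antipodeLin.lTensor U s) := by
  let B : Subalgebra k U :=
    { carrier := {w | ∀ s : U ⊗[k] U,
        LinearMap.mul' k U (antipodeLin.lTensor U (s * comulHom k g w)) =
          counitHom k g w • LinearMap.mul' k U (antipodeLin.lTensor U s)}
      mul_mem' := by
        intro a b ha hb s
        simp only [Set.mem_ofPred_eq] at ha hb
        rw [map_mul (comulHom k g), ← mul_assoc, hb, ha, map_mul (counitHom k g), mul_comm, mul_smul]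
      add_mem' := by
        intro a b ha hb s
        simp only [Set.mem_ofPred_eq] at ha hb
        rw [map_add, mul_add, map_add, map_add, ha, hb, map_add, add_smul]
      algebraMap_mem' := by
        intro c s
        rw [AlgHom.commutes, AlgHom.commutes, ← Algebra.commutes, ← Algebra.smul_def,
          map_smul, map_smul]
        rfl }
  refine mem_of_forall_ι B (fun u => ?_) w s
  intro s
  rw [comulHom_ι, counitHom_ι, zero_smul]
  induction s using TensorProduct.induction_on with
  | zero => simp
  | add p q hp hq => rw [add_mul, map_add, map_add, hp, hq, add_zero]
  | tmul p q =>
    simp [-UniversalEnvelopingAlgebra.ι_apply, mul_add, antipodeLin_mul, antipodeLin_ι, mul_assoc]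

/-- The usual Hopf algebra structure on `U(g)`, in which the elements of `g` are primitive. -/
instance instHopfAlgebra : HopfAlgebra k U where
  antipode := antipodeLin
  mul_antipode_rTensor_comul := by
    ext w
    have := antipode_left (k := k) (g := g) w 1
    rw [mul_one, Algebra.TensorProduct.one_def, LinearMap.rTensor_tmul, antipodeLin_one,
      LinearMap.mul'_apply, mul_one] at this
    simpa [comul_eq, counit_eq, Algebra.algebraMap_eq_smul_one] using this
  mul_antipode_lTensor_comul := by
    ext w
    have := antipode_right (k := k) (g := g) w 1
    rw [one_mul, Algebra.TensorProduct.one_def, LinearMap.lTensor_tmul, antipodeLin_one,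
      LinearMap.mul'_apply, mul_one] at this
    simpa [comul_eq, counit_eq, Algebra.algebraMap_eq_smul_one] using this

end UEAHopf

/-! ### Ore extensions -/

/-- The defining relations of `A[z; τ, δ]` on the free algebra with one generator `some a` for each
`a` in `A` and the generator `none` for the variable `z`: the first three make `a ↦ some a` an
algebra map, the last one is `z a = τ(a) z + δ(a)`. -/
inductive OreExtension.Rel {k : Type u} {A : Type v} [CommRing k] [Ring A] [Algebra k A]
    (τ : A →ₐ[k] A) (δ : A →ₗ[k] A) :
    FreeAlgebra k (Option A) → FreeAlgebra k (Option A) → Prop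
  | add (a b : A) : OreExtension.Rel τ δ (FreeAlgebra.ι k (some (a + b)))
      (FreeAlgebra.ι k (some a) + FreeAlgebra.ι k (some b))
  | mul (a b : A) : OreExtension.Rel τ δ (FreeAlgebra.ι k (some (a * b)))
      (FreeAlgebra.ι k (some a) * FreeAlgebra.ι k (some b))
  | scalar (c : k) : OreExtension.Rel τ δ (FreeAlgebra.ι k (some (algebraMap k A c)))
      (algebraMap k (FreeAlgebra k (Option A)) c)
  | ore (a : A) : OreExtension.Rel τ δ (FreeAlgebra.ι k none * FreeAlgebra.ι k (some a))
      (FreeAlgebra.ι k (some (τ a)) * FreeAlgebra.ι k none + FreeAlgebra.ι k (some (δ a)))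

/-- The Ore extension `A[z; τ, δ]`: the algebra generated by the algebra `A` and a variable `z` with
the relations `z a = τ(a) z + δ(a)` (used for a `τ`-derivation `δ`). -/
def OreExtension {k : Type u} {A : Type v} [CommRing k] [Ring A] [Algebra k A]
    (τ : A →ₐ[k] A) (δ : A →ₗ[k] A) : Type (max u v) :=
  RingQuot (OreExtension.Rel τ δ)

namespace OreExtension

variable {k : Type u} {A : Type v} [CommRing k] [Ring A] [Algebra k A]
  (τ : A →ₐ[k] A) (δ : A →ₗ[k] A)

instance : Ring (OreExtension τ δ) := inferInstanceAs (Ring (RingQuot (OreExtension.Rel τ δ)))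

instance : Algebra k (OreExtension τ δ) :=
  inferInstanceAs (Algebra k (RingQuot (OreExtension.Rel τ δ)))

/-- The quotient map from the free algebra. -/
def mk : FreeAlgebra k (Option A) →ₐ[k] OreExtension τ δ :=
  RingQuot.mkAlgHom k (OreExtension.Rel τ δ)

theorem mk_rel {p q : FreeAlgebra k (Option A)} (h : OreExtension.Rel τ δ p q) :
    mk τ δ p = mk τ δ q :=
  RingQuot.mkAlgHom_rel k h

/-- The variable `z`. -/
def z : OreExtension τ δ := mk τ δ (FreeAlgebra.ι k none)

/-- The structure map `A → A[z; τ, δ]`. -/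
def of : A →ₐ[k] OreExtension τ δ where
  toFun a := mk τ δ (FreeAlgebra.ι k (some a))
  map_one' := by
    have h := mk_rel τ δ (OreExtension.Rel.scalar (1 : k))
    simpa using h
  map_mul' a b := by
    have h := mk_rel τ δ (OreExtension.Rel.mul a b)
    simpa using h
  map_zero' := by
    have h := mk_rel τ δ (OreExtension.Rel.scalar (0 : k))
    simpa using h
  map_add' a b := by
    have h := mk_rel τ δ (OreExtension.Rel.add a b)
    simpa using h
  commutes' c := by
    have h := mk_rel τ δ (OreExtension.Rel.scalar c)
    simpa using h

end OreExtension

/-! ### Generalized Hopf-Ore extensions -/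

/-- A generalized Hopf-Ore extension of the Hopf algebra `A`: a Hopf algebra `carrier` whose
underlying algebra is (identified by `e` with) an Ore extension `A[z; τ, δ]`, such that `A` is a
Hopf subalgebra and `Δ z = z ⊗ r₁ + x ⊗ y + r₂ ⊗ z` with `r₁, r₂, x, y` in `A`. -/
structure GeneralizedHopfOreExtension (k : Type u) (A : Type v) [Field k] [Ring A]
    [HopfAlgebra k A] where
  τ : A →ₐ[k] A
  δ : A →ₗ[k] A
  δ_mul : ∀ a b : A, δ (a * b) = τ a * δ b + δ a * b
  carrier : Type w
  [ring : Ring carrier]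
  [hopf : HopfAlgebra k carrier]
  e : OreExtension τ δ ≃ₐ[k] carrier
  r₁ : A
  r₂ : A
  x : A
  y : A
  counit_of : ∀ a : A, Coalgebra.counit (R := k) (e (OreExtension.of τ δ a)) =
    Coalgebra.counit (R := k) a
  comul_of : ∀ a : A, Coalgebra.comul (R := k) (e (OreExtension.of τ δ a)) =
    TensorProduct.map (e.toAlgHom.comp (OreExtension.of τ δ)).toLinearMap
      (e.toAlgHom.comp (OreExtension.of τ δ)).toLinearMap (Coalgebra.comul (R := k) a)
  comul_z : Coalgebra.comul (R := k) (e (OreExtension.z τ δ)) =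
    e (OreExtension.z τ δ) ⊗ₜ[k] e (OreExtension.of τ δ r₁)
      + e (OreExtension.of τ δ x) ⊗ₜ[k] e (OreExtension.of τ δ y)
      + e (OreExtension.of τ δ r₂) ⊗ₜ[k] e (OreExtension.z τ δ)

/-- An element `a` is `(r, s)`-primitive if `Δ a = a ⊗ r + s ⊗ a`. -/
def IsSkewPrimitive (k : Type u) {A : Type v} [Field k] [Ring A] [HopfAlgebra k A]
    (r s a : A) : Prop :=
  Coalgebra.comul (R := k) a = a ⊗ₜ[k] r + s ⊗ₜ[k] a

/-- For a character `χ` and a group-like element `r`, the map `a ↦ ∑ χ(a₁) r a₂ S(r)`. -/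
def characterTwist {k : Type u} {A : Type v} [Field k] [Ring A] [HopfAlgebra k A]
    (χ : A →ₐ[k] k) (r : A) : A →ₗ[k] A :=
  (TensorProduct.lid k A).toLinearMap ∘ₗ
    TensorProduct.map χ.toLinearMap
      (LinearMap.mulRight k (HopfAlgebra.antipode k r) ∘ₗ LinearMap.mulLeft k r) ∘ₗ
    Coalgebra.comul (R := k)

namespace GeneralizedHopfOreExtension

attribute [instance] GeneralizedHopfOreExtension.ring GeneralizedHopfOreExtension.hopf

variable {k : Type u} [Field k] {A : Type v} [Ring A] [HopfAlgebra k A]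

/-- The embedding of `A` in the extension. -/
def incl (E : GeneralizedHopfOreExtension.{u, v, w} k A) : A →ₐ[k] E.carrier :=
  E.e.toAlgHom.comp (OreExtension.of E.τ E.δ)

/-- The normalization convention for the quadruple `(r₁, r₂, x, y)`: `r₁, r₂` are group-like, `x` is
`(1, r₂)`-primitive, `y` is `(r₁, 1)`-primitive, and `x = 0` if and only if `y = 0`. -/
structure IsNormalized (E : GeneralizedHopfOreExtension.{u, v, w} k A) : Prop where
  groupLike₁ : IsGroupLikeElem k E.r₁
  groupLike₂ : IsGroupLikeElem k E.r₂
  primitive_x : IsSkewPrimitive k 1 E.r₂ E.x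
  primitive_y : IsSkewPrimitive k E.r₁ 1 E.y
  x_eq_zero_iff : E.x = 0 ↔ E.y = 0

/-- `E.HasForm χ r₁ r₂ x y` says that `E` is the generalized Hopf-Ore extension
`A(χ, r₁, r₂, x, y, δ)` with `δ = E.δ`: the quadruple of `E` is `(r₁, r₂, x, y)`, it is normalized,
and `τ(a) = ∑ χ(a₁) r₁ a₂ r₁⁻¹`. -/
structure HasForm (E : GeneralizedHopfOreExtension.{u, v, w} k A)
    (χ : A →ₐ[k] k) (r₁ r₂ x y : A) : Prop where
  r₁_eq : E.r₁ = r₁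
  r₂_eq : E.r₂ = r₂
  x_eq : E.x = x
  y_eq : E.y = y
  normalized : E.IsNormalized
  τ_eq : ∀ a : A, E.τ a = characterTwist χ r₁ a

/-- Isomorphism of generalized Hopf-Ore extensions (of possibly different Hopf algebras): a Hopf
algebra isomorphism that takes `A` onto `A'`. (A bialgebra isomorphism of Hopf algebras
automatically commutes with the antipodes.) -/
def Isomorphic {A' : Type t} [Ring A'] [HopfAlgebra k A']
    (E : GeneralizedHopfOreExtension.{u, v, w} k A)
    (E' : GeneralizedHopfOreExtension.{u, t, w} k A') : Prop :=
  ∃ Ψ : E.carrier ≃ₐc[k] E'.carrier, (fun h => Ψ h) '' Set.range E.incl = Set.range E'.incl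

end GeneralizedHopfOreExtension

/-! ### The families over `U(g)` in characteristic `2` -/

/-- The span `ĝ` in `U(g)` of all `u ^ (p ^ r)` with `u` in `g` and `r ≥ 0`. -/
def restrictedHull (k : Type u) [Field k] (g : Type v) [LieRing g] [LieAlgebra k g] (p : ℕ) :
    Submodule k (UniversalEnvelopingAlgebra k g) :=
  Submodule.span k {w | ∃ (u : g) (r : ℕ), w = UniversalEnvelopingAlgebra.ι k u ^ p ^ r}

namespace HopfOreChar2

variable {k : Type u} [Field k] {g : Type v} [LieRing g] [LieAlgebra k g]

local notation "U" => UniversalEnvelopingAlgebra k g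
local notation "ιU" => UniversalEnvelopingAlgebra.ι k
local notation "ĝ" => restrictedHull k g 2

/-- The element `∑ αᵢ a^(2^i) + ∑ α'ᵢ b^(2^i)` of `U(g)`. -/
def combination (a b : g) (α α' : ℕ →₀ k) : U :=
  α.sum (fun i c => c • (ιU a : U) ^ 2 ^ i) + α'.sum (fun i c => c • (ιU b : U) ^ 2 ^ i)

/-- The sum of all the coefficients. -/
def coeffSum (α : ℕ →₀ k) : k := α.sum fun _ c => c

/-- Family (a): `U(g)(χ, 1, 1, 0, 0, δ)`, `δ(g) ⊆ ĝ`,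
`δ([a,b]) = [δ(a), b] + [a, δ(b)] + χ(a) δ(b) - χ(b) δ(a)`. -/
def FamilyA (a b : g) (E : GeneralizedHopfOreExtension.{u, max u v, w} k U) : Prop :=
  ∃ χ : U →ₐ[k] k, E.HasForm χ 1 1 0 0 ∧ (∀ u : g, E.δ (ιU u) ∈ ĝ) ∧
    E.δ (ιU ⁅a, b⁆) =
      (E.δ (ιU a) * ιU b - ιU b * E.δ (ιU a)) + (ιU a * E.δ (ιU b) - E.δ (ιU b) * ιU a)
        + χ (ιU a) • E.δ (ιU b) - χ (ιU b) • E.δ (ιU a)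

/-- Family (b): `[a,b] = 0`, `U(g)(0, 1, 1, x, y, δ)` with `x, y ∈ ĝ` nonzero, `δ(g) ⊆ ĝ`.
The character `0` is the one that vanishes on `g`. -/
def FamilyB (a b : g) (E : GeneralizedHopfOreExtension.{u, max u v, w} k U) : Prop :=
  ⁅a, b⁆ = 0 ∧ ∃ (χ : U →ₐ[k] k) (x y : U), E.HasForm χ 1 1 x y ∧ (∀ u : g, χ (ιU u) = 0) ∧
    x ∈ ĝ ∧ y ∈ ĝ ∧ x ≠ 0 ∧ y ≠ 0 ∧ ∀ u : g, E.δ (ιU u) ∈ ĝ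

/-- Family (c): `[a,b] = a`, `U(g)(0, 1, 1, x, y, δ)` with `x, y ∈ ĝ` nonzero, `α₀ y = β₀ x`,
`α' y = β' x`, `δ(a) = [δ(a), b] + [a, δ(b)]`, and one of the conditions (i), (ii). -/
def FamilyC (a b : g) (E : GeneralizedHopfOreExtension.{u, max u v, w} k U) : Prop :=
  ⁅a, b⁆ = a ∧ ∃ (χ : U →ₐ[k] k) (α α' β β' : ℕ →₀ k) (x y : U),
    x = combination a b α α' ∧ y = combination a b β β' ∧
    E.HasForm χ 1 1 x y ∧ (∀ u : g, χ (ιU u) = 0) ∧ x ≠ 0 ∧ y ≠ 0 ∧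
    α 0 • y = β 0 • x ∧ coeffSum α' • y = coeffSum β' • x ∧
    E.δ (ιU a) =
      (E.δ (ιU a) * ιU b - ιU b * E.δ (ιU a)) + (ιU a * E.δ (ιU b) - E.δ (ιU b) * ιU a) ∧
    ((x = α 0 • (ιU a : U) ∧ y = β 0 • (ιU a : U) ∧ ∀ u : g, E.δ (ιU u) ∈ ĝ) ∨
      (x ≠ α 0 • (ιU a : U) ∧
        E.δ (ιU a) - coeffSum β' • ((ιU a : U) * x) ∈ ĝ ∧
        E.δ (ιU b) - β 0 • ((ιU a : U) * x) ∈ ĝ))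

/-- Family (d): `[a,b] = a`, `U(g)(χ, 1, 1, x, y, δ)` with `χ(a) = 0`, `χ(b) = 1`, `x, y ∈ ĝ`
nonzero, `δ(g) ⊆ ĝ`, `[δ(a), b] + [a, δ(b)] = 0`, and one of the conditions (i), (ii). -/
def FamilyD (a b : g) (E : GeneralizedHopfOreExtension.{u, max u v, w} k U) : Prop :=
  ⁅a, b⁆ = a ∧ ∃ (χ : U →ₐ[k] k) (α α' β β' : ℕ →₀ k) (x y : U),
    x = combination a b α α' ∧ y = combination a b β β' ∧
    E.HasForm χ 1 1 x y ∧ χ (ιU a) = 0 ∧ χ (ιU b) = 1 ∧ x ≠ 0 ∧ y ≠ 0 ∧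
    (∀ u : g, E.δ (ιU u) ∈ ĝ) ∧
    (E.δ (ιU a) * ιU b - ιU b * E.δ (ιU a)) + (ιU a * E.δ (ιU b) - E.δ (ιU b) * ιU a) = 0 ∧
    ((x = α 0 • (ιU a : U) ∧ β 0 = 0 ∧ coeffSum β' = 0) ∨
      (α 0 = 0 ∧ coeffSum α' = 0 ∧ y = β 0 • (ιU a : U)))

/-- The condition `δ(g) ⊆ g`. -/
def PreservesLie (E : GeneralizedHopfOreExtension.{u, max u v, w} k U) : Prop := ∀ u : g, ∃ v : g, E.δ (ιU u) = ιU v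

/-- `E` is, as a Hopf algebra, the enveloping algebra of the Lie algebra `L`, by an isomorphism that
restricts on `g` to the Lie algebra map `j : g → L`. -/
def IsEnvelopingOf (E : GeneralizedHopfOreExtension.{u, max u v, w} k U) {L : Type t} [LieRing L] [LieAlgebra k L] (j : g →ₗ⁅k⁆ L) : Prop :=
  ∃ Ψ : E.carrier ≃ₐc[k] UniversalEnvelopingAlgebra k L,
    ∀ u : g, Ψ (E.incl (ιU u)) = UniversalEnvelopingAlgebra.ι k (j u)

end HopfOreChar2

end

/-!
Let `[a, b] = c a`. On the monomials `a ^ i b ^ j`, which form a basis of `U(g)`, the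
comultiplication is that of a polynomial ring, so `1` is the only group-like element and the
primitive elements are spanned by the `2 ^ i`-th powers of `a` and `b`.

Comparing the coefficients of powers of `z` in the coassociativity of `Δ z` shows that `r₁` and `r₂`
are group-like, hence `1`, and that `x ⊗ y` is a cocycle; a substitution `z ↦ z + c` then makes the
extension normalized. In a normalized extension, comparing coefficients in
`Δ z · Δ u = Δ (τ u) · Δ z + Δ (δ u)` for `u` in `g` gives `τ u = u + χ u` and
`Δ (δ u) = δ u ⊗ 1 + 1 ⊗ δ u + [x, u] ⊗ y + x ⊗ [y, u] - χ u x ⊗ y`. The last three terms thus form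
a coboundary. In characteristic `2` a coboundary is symmetric with vanishing diagonal coefficients,
and this forces the relations between `x`, `y` and `χ` that define the families.

If `x = y = 0` and `δ` preserves `g`, then `g + k z` is closed under the commutator, and a Lie
algebra is such a `g + k z` exactly when it contains `g` in codimension one.
-/

noncomputable section

attribute [local instance 100] LieRing.ofAssociativeRing
attribute [-simp] UniversalEnvelopingAlgebra.ι_apply

namespace TwoDimEnveloping

variable {k : Type u} [Field k] {g : Type v} [LieRing g] [LieAlgebra k g]

local notation "U" => UniversalEnvelopingAlgebra k g
local notation "ιU" => UniversalEnvelopingAlgebra.ι k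

/-! ### Two-dimensional Lie algebras -/

theorem eq_smul_add_smul (B : Module.Basis (Fin 2) k g) (u : g) :
    u = B.repr u 0 • B 0 + B.repr u 1 • B 1 := by
  conv_lhs => rw [← B.sum_repr u]
  rw [Fin.sum_univ_two]

theorem lie_eq_smul_lie (B : Module.Basis (Fin 2) k g) (u v : g) :
    ⁅u, v⁆ = (B.repr u 0 * B.repr v 1 - B.repr u 1 * B.repr v 0) • ⁅B 0, B 1⁆ := by
  conv_lhs => rw [eq_smul_add_smul B u, eq_smul_add_smul B v]
  simp only [add_lie, lie_add, smul_lie, lie_smul, lie_self, ← lie_skew (B 1) (B 0)]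
  module

theorem linearIndependent_pair_of_lie_ne_zero {u v : g} (h : ⁅u, v⁆ ≠ 0) :
    LinearIndependent k ![u, v] := by
  refine LinearIndependent.pair_iff.mpr fun r s hrs => ⟨?_, ?_⟩
  · have h0 : r • ⁅u, v⁆ = 0 := by
      rw [← smul_lie, eq_neg_of_add_eq_zero_left hrs, neg_lie, smul_lie, lie_self, smul_zero,
        neg_zero]
    exact (smul_eq_zero.mp h0).resolve_right h
  · have h0 : s • ⁅u, v⁆ = 0 := by
      rw [← lie_smul, eq_neg_of_add_eq_zero_right hrs, lie_neg, lie_smul, lie_self, smul_zero,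
        neg_zero]
    exact (smul_eq_zero.mp h0).resolve_right h

theorem exists_lie_eq_self (B : Module.Basis (Fin 2) k g) {w : g} (hw : w ≠ 0)
    (hB : ⁅B 0, B 1⁆ = w) : ∃ t : g, ⁅w, t⁆ = w := by
  by_cases h0 : B.repr w 0 = 0
  · have h1 : B.repr w 1 ≠ 0 := by
      intro h1
      refine hw ?_
      rw [eq_smul_add_smul B w, h0, h1, zero_smul, zero_smul, add_zero]
    refine ⟨-(B.repr w 1)⁻¹ • B 0, ?_⟩
    rw [lie_eq_smul_lie B w, hB]
    simp [h1]
  · refine ⟨(B.repr w 0)⁻¹ • B 1, ?_⟩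
    rw [lie_eq_smul_lie B w, hB]
    simp [h0]

theorem exists_basis_lie_eq (hg : Module.finrank k g = 2) :
    ∃ B : Module.Basis (Fin 2) k g, ⁅B 0, B 1⁆ = 0 ∨ ⁅B 0, B 1⁆ = B 0 := by
  have : Module.Finite k g := Module.finite_of_finrank_eq_succ hg
  let B := Module.finBasisOfFinrankEq k g hg
  by_cases hw : ⁅B 0, B 1⁆ = 0
  · exact ⟨B, Or.inl hw⟩
  obtain ⟨t, ht⟩ := exists_lie_eq_self B hw rfl
  have hlin : LinearIndependent k ![⁅B 0, B 1⁆, t] :=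
    linearIndependent_pair_of_lie_ne_zero (by rwa [ht])
  refine ⟨basisOfLinearIndependentOfCardEqFinrank hlin (by simp [hg]), Or.inr ?_⟩
  simpa using ht

theorem exists_lie_eq_smul {B : Module.Basis (Fin 2) k g}
    (hB : ⁅B 0, B 1⁆ = 0 ∨ ⁅B 0, B 1⁆ = B 0) : ∃ c : k, ⁅B 0, B 1⁆ = c • B 0 :=
  hB.elim (fun h => ⟨0, by rw [h, zero_smul]⟩) fun h => ⟨1, by rw [h, one_smul]⟩

/-! ### The Poincaré–Birkhoff–Witt basis -/

/-- Left multiplication by `a` on monomials `a ^ i * b ^ j`, in exponents. -/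
def mulA (k : Type u) [Field k] : Module.End k (ℕ × ℕ →₀ k) :=
  Finsupp.linearCombination k fun p => Finsupp.single (p.1 + 1, p.2) 1

/-- Left multiplication by `b` on monomials `a ^ i * b ^ j`, in exponents, for `[a, b] = c a`: here
`b a ^ i = a ^ i b - c i a ^ i`. -/
def mulB (c : k) : Module.End k (ℕ × ℕ →₀ k) :=
  Finsupp.linearCombination k fun p =>
    Finsupp.single (p.1, p.2 + 1) 1 - Finsupp.single p (c * (p.1 : k))

theorem mulA_single (p : ℕ × ℕ) (r : k) :
    mulA k (Finsupp.single p r) = Finsupp.single (p.1 + 1, p.2) r := by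
  simp [mulA]

theorem mulB_single (c : k) (p : ℕ × ℕ) (r : k) :
    mulB c (Finsupp.single p r) =
      Finsupp.single (p.1, p.2 + 1) r - Finsupp.single p (r * (c * (p.1 : k))) := by
  rw [mulB, Finsupp.linearCombination_single, smul_sub, Finsupp.smul_single, Finsupp.smul_single,
    smul_eq_mul, smul_eq_mul, mul_one]

theorem mulA_mul_mulB (c : k) : mulA k * mulB c = c • mulA k + mulB c * mulA k := by
  refine Finsupp.lhom_ext fun p r => ?_
  have hr : r * (c * ((p.1 + 1 : ℕ) : k)) = r * (c * (p.1 : k)) + c • r := by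
    push_cast
    rw [smul_eq_mul]
    ring
  simp only [LinearMap.add_apply, Module.End.mul_apply, mulB_single, mulA_single, map_sub,
    LinearMap.smul_apply, Finsupp.smul_single, hr, Finsupp.single_add]
  abel

variable {B : Module.Basis (Fin 2) k g} {c : k}

/-- The representation of `U(g)` on exponents of monomials, where `[a, b] = c a`. -/
def monomialRep (hB : ⁅B 0, B 1⁆ = c • B 0) : U →ₐ[k] Module.End k (ℕ × ℕ →₀ k) :=
  UniversalEnvelopingAlgebra.lift k
    { B.constr k ![mulA k, mulB c] with
      map_lie' := by
        intro u v
        simp only [Module.Basis.constr_apply_fintype, Fin.sum_univ_two, Module.Basis.equivFun_apply,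
          AddHom.toFun_eq_coe, LinearMap.coe_toAddHom, Matrix.cons_val_zero, Matrix.cons_val_one]
        rw [lie_eq_smul_lie B, hB]
        simp only [map_smul, Finsupp.smul_apply, Module.Basis.repr_self, Finsupp.single_eq_same,
          Finsupp.single_eq_of_ne one_ne_zero, LieRing.of_associative_ring_bracket, add_mul,
          mul_add, smul_mul_assoc, mul_smul_comm, mulA_mul_mulB]
        module }

theorem monomialRep_ι_zero (hB : ⁅B 0, B 1⁆ = c • B 0) : monomialRep hB (ιU (B 0)) = mulA k := by
  rw [monomialRep, UniversalEnvelopingAlgebra.lift_ι_apply]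
  exact B.constr_basis k ![mulA k, mulB c] 0

theorem monomialRep_ι_one (hB : ⁅B 0, B 1⁆ = c • B 0) : monomialRep hB (ιU (B 1)) = mulB c := by
  rw [monomialRep, UniversalEnvelopingAlgebra.lift_ι_apply]
  exact B.constr_basis k ![mulA k, mulB c] 1

/-- The monomial `a ^ i * b ^ j` in `U(g)`. -/
def monomial (B : Module.Basis (Fin 2) k g) (p : ℕ × ℕ) : U :=
  (ιU (B 0) : U) ^ p.1 * (ιU (B 1) : U) ^ p.2

theorem monomialRep_monomial (hB : ⁅B 0, B 1⁆ = c • B 0) (p : ℕ × ℕ) :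
    monomialRep hB (monomial B p) (Finsupp.single 0 1) = Finsupp.single p 1 := by
  have hb (j : ℕ) : (mulB c ^ j) (Finsupp.single 0 1) = Finsupp.single (0, j) 1 := by
    induction j with
    | zero => rw [pow_zero]; rfl
    | succ j ih => rw [pow_succ', Module.End.mul_apply, ih, mulB_single]; simp
  have ha (i j : ℕ) : (mulA k ^ i) (Finsupp.single (0, j) 1) = Finsupp.single (i, j) 1 := by
    induction i with
    | zero => simp
    | succ i ih => rw [pow_succ', Module.End.mul_apply, ih, mulA_single]
  rw [monomial, map_mul, map_pow, map_pow, monomialRep_ι_zero, monomialRep_ι_one,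
    Module.End.mul_apply, hb, ha]

theorem linearIndependent_monomial (hB : ⁅B 0, B 1⁆ = c • B 0) :
    LinearIndependent k (monomial B) := by
  let coords : U →ₗ[k] (ℕ × ℕ →₀ k) :=
    LinearMap.applyₗ (Finsupp.single 0 1) ∘ₗ (monomialRep hB).toLinearMap
  have h : coords ∘ monomial B = fun p => Finsupp.single p 1 :=
    funext fun p => monomialRep_monomial hB p
  refine LinearIndependent.of_comp coords ?_
  rw [h]
  exact Finsupp.basisSingleOne.linearIndependent

theorem ι_mul_sub_ι_mul (hB : ⁅B 0, B 1⁆ = c • B 0) :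
    (ιU (B 0) : U) * ιU (B 1) - ιU (B 1) * ιU (B 0) = c • ιU (B 0) := by
  rw [← map_smul, ← hB, LieHom.map_lie, LieRing.of_associative_ring_bracket]

theorem ι_mul_ι_pow (hB : ⁅B 0, B 1⁆ = c • B 0) (i : ℕ) :
    (ιU (B 1) : U) * ιU (B 0) ^ i =
      ιU (B 0) ^ i * ιU (B 1) - (c * (i : k)) • (ιU (B 0) : U) ^ i := by
  induction i with
  | zero => simp
  | succ i ih =>
    have h : (ιU (B 1) : U) * ιU (B 0) = ιU (B 0) * ιU (B 1) - c • ιU (B 0) := by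
      rw [← ι_mul_sub_ι_mul hB]; abel
    rw [pow_succ, ← mul_assoc, ih, sub_mul, mul_assoc, h, mul_sub, mul_assoc, smul_mul_assoc,
      mul_smul_comm, ← pow_succ]
    push_cast
    module

theorem ι_mul_monomial_mem_span (hB : ⁅B 0, B 1⁆ = c • B 0) (u : g) (p : ℕ × ℕ) :
    (ιU u : U) * monomial B p ∈ Submodule.span k (Set.range (monomial B)) := by
  have hmem (q : ℕ × ℕ) : monomial B q ∈ Submodule.span k (Set.range (monomial B)) :=
    Submodule.subset_span ⟨q, rfl⟩
  have ha : (ιU (B 0) : U) * monomial B p = monomial B (p.1 + 1, p.2) := by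
    rw [monomial, monomial, ← mul_assoc, pow_succ']
  have hb : (ιU (B 1) : U) * monomial B p =
      monomial B (p.1, p.2 + 1) - (c * (p.1 : k)) • monomial B p := by
    rw [monomial, monomial, ← mul_assoc, ι_mul_ι_pow hB, sub_mul, mul_assoc, ← pow_succ',
      smul_mul_assoc]
  rw [eq_smul_add_smul B u, map_add, map_smul, map_smul, add_mul, smul_mul_assoc, smul_mul_assoc,
    ha, hb]
  exact add_mem (Submodule.smul_mem _ _ (hmem _))
    (Submodule.smul_mem _ _ (sub_mem (hmem _) (Submodule.smul_mem _ _ (hmem _))))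

theorem span_range_monomial (hB : ⁅B 0, B 1⁆ = c • B 0) :
    Submodule.span k (Set.range (monomial B)) = ⊤ := by
  set S := Submodule.span k (Set.range (monomial B))
  let stabilizer : Subalgebra k U :=
    { carrier := {w | ∀ m ∈ S, w * m ∈ S}
      mul_mem' := fun hv hw m hm => by rw [mul_assoc]; exact hv _ (hw _ hm)
      add_mem' := fun hv hw m hm => by rw [add_mul]; exact add_mem (hv _ hm) (hw _ hm)
      algebraMap_mem' := fun r m hm => by rw [← Algebra.smul_def]; exact S.smul_mem r hm }
  have hι (u : g) : (ιU u : U) ∈ stabilizer := by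
    have hle : S ≤ S.comap (LinearMap.mulLeft k (ιU u : U)) :=
      Submodule.span_le.mpr (Set.range_subset_iff.mpr (ι_mul_monomial_mem_span hB u))
    exact fun m hm => hle hm
  have hone : (1 : U) ∈ S := Submodule.subset_span ⟨0, by simp [monomial]⟩
  refine eq_top_iff.mpr fun w _ => ?_
  rw [← mul_one w]
  exact UEAHopf.mem_of_forall_ι stabilizer hι w 1 hone

/-- The Poincaré–Birkhoff–Witt basis `a ^ i * b ^ j` of `U(g)`, where `[a, b] = c a`. -/
def pbwBasis (hB : ⁅B 0, B 1⁆ = c • B 0) : Module.Basis (ℕ × ℕ) k U :=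
  Module.Basis.mk (linearIndependent_monomial hB) (span_range_monomial hB).ge

theorem pbwBasis_apply (hB : ⁅B 0, B 1⁆ = c • B 0) (p : ℕ × ℕ) :
    pbwBasis hB p = monomial B p :=
  Module.Basis.mk_apply _ _ p

theorem pbwBasis_zero (hB : ⁅B 0, B 1⁆ = c • B 0) : pbwBasis hB 0 = 1 := by
  simp [pbwBasis_apply, monomial]

theorem pbwBasis_pow_zero (hB : ⁅B 0, B 1⁆ = c • B 0) (n : ℕ) :
    pbwBasis hB (n, 0) = ιU (B 0) ^ n := by
  simp [pbwBasis_apply, monomial]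

theorem pbwBasis_zero_pow (hB : ⁅B 0, B 1⁆ = c • B 0) (n : ℕ) :
    pbwBasis hB (0, n) = ιU (B 1) ^ n := by
  simp [pbwBasis_apply, monomial]

open Finset.HasAntidiagonal (antidiagonal mem_antidiagonal)

theorem comul_monomial (B : Module.Basis (Fin 2) k g) (p : ℕ × ℕ) :
    Coalgebra.comul (R := k) (monomial B p) =
      ∑ m ∈ antidiagonal p.1, ∑ n ∈ antidiagonal p.2,
        ((p.1.choose m.1 * p.2.choose n.1 : ℕ) : k) •
          (monomial B (m.1, n.1) ⊗ₜ[k] monomial B (m.2, n.2)) := by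
  have hcomm (u : g) : Commute ((ιU u : U) ⊗ₜ[k] (1 : U)) ((1 : U) ⊗ₜ[k] (ιU u : U)) := by
    simp [commute_iff_eq]
  rw [UEAHopf.comul_eq, monomial, map_mul, map_pow, map_pow, UEAHopf.comulHom_ι,
    UEAHopf.comulHom_ι, (hcomm _).add_pow', (hcomm _).add_pow', Finset.sum_mul_sum]
  refine Finset.sum_congr rfl fun m _ => Finset.sum_congr rfl fun n _ => ?_
  rw [smul_mul_smul_comm, Nat.cast_smul_eq_nsmul]
  simp only [Algebra.TensorProduct.tmul_pow, one_pow, Algebra.TensorProduct.tmul_mul_tmul, mul_one,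
    one_mul, monomial]

theorem sum_antidiagonal_choose_ite (n s t : ℕ) :
    (∑ m ∈ antidiagonal n, if m = (s, t) then (n.choose m.1 : k) else 0) =
      if n = s + t then ((s + t).choose s : k) else 0 := by
  rw [Finset.sum_ite_eq']
  simp only [mem_antidiagonal]
  grind

theorem repr_comul (hB : ⁅B 0, B 1⁆ = c • B 0) (p q : ℕ × ℕ) (w : U) :
    ((pbwBasis hB).tensorProduct (pbwBasis hB)).repr (Coalgebra.comul (R := k) w) (p, q) =
      ((p.1 + q.1).choose p.1 * (p.2 + q.2).choose p.2 : ℕ) * (pbwBasis hB).repr w (p + q) := by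
  set b := pbwBasis hB
  suffices h : (b.tensorProduct b).coord (p, q) ∘ₗ Coalgebra.comul (R := k) =
      (((p.1 + q.1).choose p.1 * (p.2 + q.2).choose p.2 : ℕ) : k) • b.coord (p + q) from
    DFunLike.congr_fun h w
  refine b.ext fun r => ?_
  have hterm (m n : ℕ × ℕ) : (b.tensorProduct b).coord (p, q) (((r.1.choose m.1 *
      r.2.choose n.1 : ℕ) : k) • (monomial B (m.1, n.1) ⊗ₜ[k] monomial B (m.2, n.2))) =
      (if m = (p.1, q.1) then (r.1.choose m.1 : k) else 0) *
        (if n = (p.2, q.2) then (r.2.choose n.1 : k) else 0) := by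
    rw [← pbwBasis_apply hB, ← pbwBasis_apply hB, map_smul, Module.Basis.coord_apply,
      Module.Basis.tensorProduct_repr_tmul_apply]
    simp only [b, Module.Basis.repr_self, Finsupp.single_apply, Prod.ext_iff, smul_eq_mul]
    grind
  rw [LinearMap.comp_apply, pbwBasis_apply hB, comul_monomial]
  simp only [map_sum, hterm]
  rw [← Finset.sum_mul_sum, sum_antidiagonal_choose_ite, sum_antidiagonal_choose_ite]
  simp only [LinearMap.smul_apply, Module.Basis.coord_apply, ← pbwBasis_apply hB]
  simp only [b, Module.Basis.repr_self, Finsupp.single_apply, Prod.ext_iff, smul_eq_mul,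
    Prod.fst_add, Prod.snd_add]
  grind

/-! ### Group-like and primitive elements of the enveloping algebra -/

theorem exists_not_dvd_choose {p n : ℕ} (hp : p.Prime) (h0 : n ≠ 0) (h : ∀ r, n ≠ p ^ r) :
    ∃ s t, s ≠ 0 ∧ t ≠ 0 ∧ s + t = n ∧ ¬ p ∣ n.choose s := by
  have : Fact p.Prime := ⟨hp⟩
  induction n using Nat.strong_induction_on with
  | _ n ih =>
    by_cases hpn : p ∣ n
    · obtain ⟨m, rfl⟩ := hpn
      have hm : m ≠ 0 := right_ne_zero_of_mul h0
      obtain ⟨s, t, hs, ht, rfl, hd⟩ := ih m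
        (lt_mul_of_one_lt_left (Nat.pos_of_ne_zero hm) hp.one_lt) hm
        fun r hr => h (r + 1) (by rw [hr, pow_succ'])
      refine ⟨p * s, p * t, mul_ne_zero hp.ne_zero hs, mul_ne_zero hp.ne_zero ht,
        (mul_add p s t).symm, fun hd' => hd ?_⟩
      have lucas := Choose.choose_modEq_choose_mod_mul_choose_div_nat (n := p * (s + t))
        (k := p * s) (p := p)
      rw [Nat.mul_mod_right, Nat.mul_mod_right, Nat.choose_self, one_mul,
        Nat.mul_div_cancel_left _ hp.pos, Nat.mul_div_cancel_left _ hp.pos] at lucas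
      exact (lucas.dvd_iff (dvd_refl p)).mp hd'
    · have h1 : n ≠ 1 := by simpa using h 0
      exact ⟨1, n - 1, one_ne_zero, by omega, by omega, by rwa [Nat.choose_one_right]⟩

variable (k) in
theorem add_self_eq_zero_of_charTwo [CharP k 2] {M : Type*} [AddCommGroup M] [Module k M] (m : M) :
    m + m = 0 := by
  rw [← two_smul k m, CharTwo.two_eq_zero, zero_smul]

variable (k) in
theorem neg_eq_of_charTwo [CharP k 2] {M : Type*} [AddCommGroup M] [Module k M] (m : M) : -m = m :=
  neg_eq_of_add_eq_zero_left (add_self_eq_zero_of_charTwo k m)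

section Enveloping

variable (hB : ⁅B 0, B 1⁆ = c • B 0)

theorem repr_one (p : ℕ × ℕ) : (pbwBasis hB).repr 1 p = if p = 0 then 1 else 0 := by
  rw [← pbwBasis_zero hB, Module.Basis.repr_self, Finsupp.single_apply]
  simp only [eq_comm]

theorem repr_ι_zero (p : ℕ × ℕ) :
    (pbwBasis hB).repr (ιU (B 0)) p = if p = (1, 0) then 1 else 0 := by
  have h := pbwBasis_pow_zero hB 1
  rw [pow_one] at h
  rw [← h, Module.Basis.repr_self, Finsupp.single_apply]
  simp only [eq_comm]

include hB in
theorem ι_injective : Function.Injective (ιU : g → U) := by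
  have hlin : LinearIndependent k ![(ιU (B 0) : U), ιU (B 1)] := by
    convert (linearIndependent_monomial hB).comp ![((1 : ℕ), (0 : ℕ)), (0, 1)] (by decide) using 1
    funext i
    fin_cases i <;> simp [monomial]
  refine (injective_iff_map_eq_zero (ιU : g →ₗ⁅k⁆ U)).mpr fun u hu => ?_
  rw [eq_smul_add_smul B u, map_add, map_smul, map_smul] at hu
  obtain ⟨h0, h1⟩ := LinearIndependent.pair_iff.mp hlin _ _ hu
  rw [eq_smul_add_smul B u, h0, h1, zero_smul, zero_smul, add_zero]

include hB in
/-- The finite set of exponents of a group-like element is closed under doubling. -/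
theorem eq_one_of_isGroupLikeElem {w : U} (hw : IsGroupLikeElem k w) : w = 1 := by
  set b := pbwBasis hB
  have hdouble {p : ℕ × ℕ} (hp : p ∈ (b.repr w).support) : p + p ∈ (b.repr w).support := by
    have h := repr_comul hB p p w
    rw [hw.comul_eq_tmul_self, Module.Basis.tensorProduct_repr_tmul_apply] at h
    rw [Finsupp.mem_support_iff] at hp ⊢
    exact right_ne_zero_of_mul (ne_of_eq_of_ne h.symm (mul_ne_zero hp hp))
  have hzero {p : ℕ × ℕ} (hp : p ∈ (b.repr w).support) : p = 0 := by
    obtain ⟨q, hq, hmax⟩ :=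
      Finset.exists_max_image (b.repr w).support (fun p => p.1 + p.2) ⟨p, hp⟩
    have h1 := hmax _ (hdouble hq)
    have h2 := hmax p hp
    simp only [Prod.fst_add, Prod.snd_add] at h1
    exact Prod.ext (by simp only [Prod.fst_zero]; omega) (by simp only [Prod.snd_zero]; omega)
  have hscalar : w = b.repr w 0 • 1 := by
    refine b.ext_elem fun p => ?_
    rw [map_smul, Finsupp.smul_apply, repr_one, smul_eq_mul, mul_ite, mul_one, mul_zero]
    split_ifs with hp
    · rw [hp]
    · exact Finsupp.notMem_support_iff.mp fun h => hp (hzero h)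
  have hcounit := hw.counit_eq_one
  rw [hscalar, map_smul, Bialgebra.counit_one, smul_eq_mul, mul_one] at hcounit
  rw [hscalar, hcounit, one_smul]

/-- `t` is a coboundary of the cobar complex of `A`: it measures the failure of some element `d` of
`A` to be primitive. -/
def IsCoboundary (k : Type u) {A : Type w} [Field k] [Ring A] [Bialgebra k A] (t : A ⊗[k] A) :
    Prop :=
  ∃ d : A, Coalgebra.comul (R := k) d = d ⊗ₜ[k] (1 : A) + (1 : A) ⊗ₜ[k] d + t

theorem repr_of_comul_eq {d : U} {t : U ⊗[k] U}
    (h : Coalgebra.comul (R := k) d = d ⊗ₜ[k] (1 : U) + (1 : U) ⊗ₜ[k] d + t) {p q : ℕ × ℕ}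
    (hp : p ≠ 0) (hq : q ≠ 0) : ((pbwBasis hB).tensorProduct (pbwBasis hB)).repr t (p, q) =
      ((p.1 + q.1).choose p.1 * (p.2 + q.2).choose p.2 : ℕ) * (pbwBasis hB).repr d (p + q) := by
  rw [← repr_comul hB, h]
  simp [Module.Basis.tensorProduct_repr_tmul_apply, repr_one, hp, hq]

theorem IsCoboundary.repr_symm {t : U ⊗[k] U} (ht : IsCoboundary k t) (p q : ℕ × ℕ) :
    ((pbwBasis hB).tensorProduct (pbwBasis hB)).repr t (p, q) =
      ((pbwBasis hB).tensorProduct (pbwBasis hB)).repr t (q, p) := by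
  obtain ⟨d, hd⟩ := ht
  have h : t = Coalgebra.comul (R := k) d - d ⊗ₜ[k] (1 : U) - (1 : U) ⊗ₜ[k] d := by
    rw [hd]; abel
  rw [h]
  simp only [map_sub, Finsupp.sub_apply, repr_comul, Module.Basis.tensorProduct_repr_tmul_apply,
    smul_eq_mul]
  rw [add_comm q p, add_comm q.1, add_comm q.2, Nat.choose_symm_add, Nat.choose_symm_add]
  ring

theorem IsCoboundary.repr_self_eq_zero [CharP k 2] {t : U ⊗[k] U} (ht : IsCoboundary k t)
    {p : ℕ × ℕ} (hp : p ≠ 0) :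
    ((pbwBasis hB).tensorProduct (pbwBasis hB)).repr t (p, p) = 0 := by
  obtain ⟨d, hd⟩ := ht
  have hcentral {n : ℕ} (hn : n ≠ 0) : 2 ∣ (n + n).choose n := by
    rw [← two_mul]
    exact Nat.two_dvd_centralBinom_of_one_le (Nat.one_le_iff_ne_zero.mpr hn)
  have heven : 2 ∣ (p.1 + p.1).choose p.1 * (p.2 + p.2).choose p.2 := by
    by_cases h1 : p.1 = 0
    · exact (hcentral fun h2 => hp (Prod.ext h1 h2)).mul_left _
    · exact (hcentral h1).mul_right _
  rw [repr_of_comul_eq hB hd hp hp, (CharP.cast_eq_zero_iff k 2 _).mpr heven, zero_mul]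

theorem repr_zero_of_isSkewPrimitive {w : U} (hw : IsSkewPrimitive k 1 1 w) :
    (pbwBasis hB).repr w 0 = 0 := by
  have h := repr_comul hB 0 0 w
  rw [hw] at h
  simpa [Module.Basis.tensorProduct_repr_tmul_apply, repr_one] using h

section Primitive

variable (r : ℕ) [CharP k r]

theorem repr_eq_zero_of_isSkewPrimitive (hr : r.Prime) {w : U} (hw : IsSkewPrimitive k 1 1 w)
    {p : ℕ × ℕ} (h1 : ∀ i, p ≠ (r ^ i, 0)) (h2 : ∀ i, p ≠ (0, r ^ i)) :
    (pbwBasis hB).repr w p = 0 := by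
  have hsplit {q q' : ℕ × ℕ} (hq : q ≠ 0) (hq' : q' ≠ 0)
      (h : ¬ r ∣ (q + q').1.choose q.1 * (q + q').2.choose q.2) :
      (pbwBasis hB).repr w (q + q') = 0 := by
    have h0 := repr_of_comul_eq hB (hw.trans (add_zero _).symm) hq hq'
    rw [map_zero, Finsupp.zero_apply] at h0
    exact (mul_eq_zero.mp h0.symm).resolve_left fun h' => h ((CharP.cast_eq_zero_iff k r _).mp h')
  obtain ⟨i, j⟩ := p
  rcases eq_or_ne i 0 with rfl | hi <;> rcases eq_or_ne j 0 with rfl | hj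
  · exact repr_zero_of_isSkewPrimitive hB hw
  · obtain ⟨s, t, hs, ht, rfl, hd⟩ := exists_not_dvd_choose hr hj fun i hi => h2 i (by rw [hi])
    exact hsplit (q := (0, s)) (q' := (0, t)) (by simpa) (by simpa) (by simpa using hd)
  · obtain ⟨s, t, hs, ht, rfl, hd⟩ := exists_not_dvd_choose hr hi fun i hi => h1 i (by rw [hi])
    exact hsplit (q := (s, 0)) (q' := (t, 0)) (by simpa) (by simpa) (by simpa using hd)
  · simpa using hsplit (q := (i, 0)) (q' := (0, j)) (by simpa) (by simpa)
      (by simpa using hr.one_lt.ne')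

include hB in
theorem mem_restrictedHull_of_isSkewPrimitive (hr : r.Prime) {w : U}
    (hw : IsSkewPrimitive k 1 1 w) : w ∈ restrictedHull k g r := by
  rw [← (pbwBasis hB).linearCombination_repr w]
  refine sum_mem fun p hp => Submodule.smul_mem _ _ (Submodule.subset_span ?_)
  rw [Finsupp.mem_support_iff] at hp
  by_cases h1 : ∃ i, p = (r ^ i, 0)
  · obtain ⟨i, rfl⟩ := h1
    exact ⟨B 0, i, pbwBasis_pow_zero hB _⟩
  by_cases h2 : ∃ i, p = (0, r ^ i)
  · obtain ⟨i, rfl⟩ := h2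
    exact ⟨B 1, i, pbwBasis_zero_pow hB _⟩
  push Not at h1 h2
  exact absurd (repr_eq_zero_of_isSkewPrimitive hB r hr hw h1 h2) hp

end Primitive

end Enveloping

/-! ### Primitive elements in characteristic two -/

section Combination

variable (hB : ⁅B 0, B 1⁆ = c • B 0)

/-- The coefficients of the powers `a ^ (2 ^ i)` in an element of `U(g)`. -/
def coeffsA (w : U) : ℕ →₀ k :=
  ((pbwBasis hB).repr w).comapDomain (fun i => (2 ^ i, 0)) fun _ _ _ _ h =>
    Nat.pow_right_injective le_rfl (Prod.ext_iff.mp h).1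

/-- The coefficients of the powers `b ^ (2 ^ i)` in an element of `U(g)`. -/
def coeffsB (w : U) : ℕ →₀ k :=
  ((pbwBasis hB).repr w).comapDomain (fun i => (0, 2 ^ i)) fun _ _ _ _ h =>
    Nat.pow_right_injective le_rfl (Prod.ext_iff.mp h).2

theorem repr_combination (α α' : ℕ →₀ k) (p : ℕ × ℕ) :
    (pbwBasis hB).repr (HopfOreChar2.combination (B 0) (B 1) α α') p =
      (α.sum fun i r => if (2 ^ i, 0) = p then r else 0) +
        α'.sum fun i r => if (0, 2 ^ i) = p then r else 0 := by
  simp [HopfOreChar2.combination, Finsupp.sum, ← pbwBasis_pow_zero hB, ← pbwBasis_zero_pow hB,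
    Finsupp.single_apply]

theorem eq_combination_of_isSkewPrimitive [CharP k 2] {w : U} (hw : IsSkewPrimitive k 1 1 w) :
    w = HopfOreChar2.combination (B 0) (B 1) (coeffsA hB w) (coeffsB hB w) := by
  have hpow (i : ℕ) : (2 : ℕ) ^ i ≠ 0 := by positivity
  refine (pbwBasis hB).ext_elem fun p => ?_
  rw [repr_combination]
  by_cases h1 : ∃ i, p = (2 ^ i, 0)
  · obtain ⟨i, rfl⟩ := h1
    simp only [Prod.mk.injEq, Nat.pow_right_inj one_lt_two, and_true, (hpow _).symm, false_and,
      if_false, Finsupp.sum_fun_zero, add_zero, Finsupp.sum_ite_self_eq']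
    rfl
  by_cases h2 : ∃ i, p = (0, 2 ^ i)
  · obtain ⟨i, rfl⟩ := h2
    simp only [Prod.mk.injEq, Nat.pow_right_inj one_lt_two, true_and, (hpow _).symm, and_false,
      if_false, Finsupp.sum_fun_zero, zero_add, Finsupp.sum_ite_self_eq']
    rfl
  push Not at h1 h2
  rw [repr_eq_zero_of_isSkewPrimitive hB 2 Nat.prime_two hw h1 h2]
  simp [fun i => (h1 i).symm, fun i => (h2 i).symm]

end Combination

theorem commute_ι_of_lie_eq_zero (hB : ⁅B 0, B 1⁆ = 0) (w : U) (u : g) :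
    Commute w (ιU u) := by
  refine (Subalgebra.mem_centralizer_iff k (s := {(ιU u : U)})).mp
    (UEAHopf.mem_of_forall_ι _ (fun v => ?_) w) _ rfl |>.symm
  rw [Subalgebra.mem_centralizer_iff]
  rintro _ rfl
  rw [← sub_eq_zero, ← LieRing.of_associative_ring_bracket, ← LieHom.map_lie, lie_eq_smul_lie B, hB,
    smul_zero, map_zero]

section Commutators

variable [CharP k 2] (hB : ⁅B 0, B 1⁆ = (1 : k) • B 0)

include hB in
theorem ι_pow_two_pow_mul_ι (i : ℕ) : (ιU (B 1) : U) ^ 2 ^ i * ιU (B 0) =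
    ιU (B 0) * ιU (B 1) ^ 2 ^ i + ιU (B 0) := by
  induction i with
  | zero =>
    have h := ι_mul_sub_ι_mul hB
    rw [one_smul, sub_eq_iff_eq_add] at h
    rw [pow_zero, pow_one, h, add_right_comm, add_self_eq_zero_of_charTwo k, zero_add]
  | succ i ih =>
    rw [pow_succ, pow_mul, sq, mul_assoc, ih, mul_add, ← mul_assoc, ih, add_mul, mul_assoc,
      add_assoc, ← add_assoc _ _ (ιU (B 0) : U), add_self_eq_zero_of_charTwo k, zero_add]

include hB in
theorem combination_mul_ι_zero_sub (α α' : ℕ →₀ k) :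
    HopfOreChar2.combination (B 0) (B 1) α α' * ιU (B 0) -
      ιU (B 0) * HopfOreChar2.combination (B 0) (B 1) α α' =
        HopfOreChar2.coeffSum α' • (ιU (B 0) : U) := by
  simp only [HopfOreChar2.combination, HopfOreChar2.coeffSum, Finsupp.sum, add_mul, mul_add,
    Finset.sum_mul, Finset.mul_sum, smul_mul_assoc, mul_smul_comm, ι_pow_two_pow_mul_ι hB,
    ← pow_succ, ← pow_succ', smul_add, Finset.sum_add_distrib, Finset.sum_smul]
  abel

include hB in
/-- Only `α 0` survives, because `b a ^ n = a ^ n b - n a ^ n`. -/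
theorem combination_mul_ι_one_sub (α α' : ℕ →₀ k) :
    HopfOreChar2.combination (B 0) (B 1) α α' * ιU (B 1) -
      ιU (B 1) * HopfOreChar2.combination (B 0) (B 1) α α' = α 0 • (ιU (B 0) : U) := by
  have hcast (i : ℕ) : ((2 ^ i : ℕ) : k) = if i = 0 then 1 else 0 := by
    split_ifs with hi
    · simp [hi]
    · exact (CharP.cast_eq_zero_iff k 2 _).mpr (dvd_pow_self 2 hi)
  have hsum : ∑ i ∈ α.support, α i • (if i = 0 then (1 : k) else 0) • (ιU (B 0) : U) ^ 2 ^ i =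
      α 0 • (ιU (B 0) : U) := by
    rw [Finset.sum_eq_single 0]
    · simp
    · intro i _ hi
      simp [hi]
    · intro hi
      simp [Finsupp.notMem_support_iff.mp hi]
  simp only [HopfOreChar2.combination, Finsupp.sum, add_mul, mul_add,
    Finset.sum_mul, Finset.mul_sum, smul_mul_assoc, mul_smul_comm, ι_mul_ι_pow hB,
    ← pow_succ, ← pow_succ', smul_sub, Finset.sum_sub_distrib, one_mul, hcast, hsum]
  abel

theorem mul_ι_zero_sub_of_isSkewPrimitive {w : U} (hw : IsSkewPrimitive k 1 1 w) :
    w * ιU (B 0) - ιU (B 0) * w = HopfOreChar2.coeffSum (coeffsB hB w) • (ιU (B 0) : U) := by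
  rw [← combination_mul_ι_zero_sub hB (coeffsA hB w), ← eq_combination_of_isSkewPrimitive hB hw]

theorem mul_ι_one_sub_of_isSkewPrimitive {w : U} (hw : IsSkewPrimitive k 1 1 w) :
    w * ιU (B 1) - ιU (B 1) * w = coeffsA hB w 0 • (ιU (B 0) : U) := by
  rw [← combination_mul_ι_one_sub hB _ (coeffsB hB w), ← eq_combination_of_isSkewPrimitive hB hw]

end Commutators

section Coboundary

theorem eq_zero_or_eq_zero_of_mul_symm {ι : Type*} {X Y : ι → k}
    (hsymm : ∀ p q, X p * Y q = X q * Y p) (hdiag : ∀ p, X p * Y p = 0) : X = 0 ∨ Y = 0 := by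
  refine or_iff_not_imp_left.mpr fun hX => ?_
  obtain ⟨p, hp⟩ := Function.ne_iff.mp hX
  have hYp : Y p = 0 := (mul_eq_zero.mp (hdiag p)).resolve_left hp
  funext q
  exact (mul_eq_zero.mp ((hsymm p q).trans (by rw [hYp, mul_zero]))).resolve_left hp

variable (hB : ⁅B 0, B 1⁆ = c • B 0)

theorem coeffsA_zero (w : U) : coeffsA hB w 0 = (pbwBasis hB).repr w (1, 0) := rfl

theorem coeffSum_coeffsB_smul_ι_zero (r : k) :
    HopfOreChar2.coeffSum (coeffsB hB (r • (ιU (B 0) : U))) = 0 := by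
  have h : coeffsB hB (r • (ιU (B 0) : U)) = 0 := by
    ext i
    simp [coeffsB, repr_ι_zero]
  rw [h, HopfOreChar2.coeffSum, Finsupp.sum_zero_index]

variable {x y : UniversalEnvelopingAlgebra k g}

theorem repr_twistedTensor (s r l : k) (p q : ℕ × ℕ) :
    ((pbwBasis hB).tensorProduct (pbwBasis hB)).repr
        (s • ((ιU (B 0) : U) ⊗ₜ[k] y) + r • (x ⊗ₜ[k] (ιU (B 0) : U)) + l • (x ⊗ₜ[k] y)) (p, q) =
      s * ((if p = (1, 0) then 1 else 0) * (pbwBasis hB).repr y q) +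
        r * ((pbwBasis hB).repr x p * if q = (1, 0) then 1 else 0) +
        l * ((pbwBasis hB).repr x p * (pbwBasis hB).repr y q) := by
  simp only [map_add, map_smul, Finsupp.add_apply, Finsupp.smul_apply, smul_eq_mul,
    Module.Basis.tensorProduct_repr_tmul_apply, repr_ι_zero]
  ring

theorem eq_smul_ι_zero_of_repr_eq_zero {w : U}
    (h : ∀ p, p ≠ (1, 0) → (pbwBasis hB).repr w p = 0) :
    w = coeffsA hB w 0 • (ιU (B 0) : U) := by
  refine (pbwBasis hB).ext_elem fun p => ?_
  rw [map_smul, Finsupp.smul_apply, repr_ι_zero, smul_eq_mul, mul_ite, mul_one, mul_zero]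
  split_ifs with hp
  · rw [hp, coeffsA_zero]
  · exact h p hp

include hB in
theorem sub_smul_mul_mem_restrictedHull {p : ℕ} [CharP k p] (hp : p.Prime)
    (hx : IsSkewPrimitive k 1 1 x) {s r : k} (hsr : s • y = r • x) {d : U}
    (hd : Coalgebra.comul (R := k) d = d ⊗ₜ[k] (1 : U) + (1 : U) ⊗ₜ[k] d +
      (s • ((ιU (B 0) : U) ⊗ₜ[k] y) + r • (x ⊗ₜ[k] (ιU (B 0) : U)))) :
    d - r • (ιU (B 0) * x) ∈ restrictedHull k g p := by
  refine mem_restrictedHull_of_isSkewPrimitive hB p hp ?_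
  rw [IsSkewPrimitive] at hx ⊢
  rw [map_sub, map_smul, Bialgebra.comul_mul, hd, hx, UEAHopf.comul_eq, UEAHopf.comulHom_ι,
    ← TensorProduct.tmul_smul, hsr]
  simp only [add_mul, mul_add, Algebra.TensorProduct.tmul_mul_tmul, one_mul, mul_one, smul_add,
    TensorProduct.sub_tmul, TensorProduct.tmul_sub, TensorProduct.smul_tmul',
    TensorProduct.tmul_smul]
  abel

variable [CharP k 2]

include hB in
theorem smul_eq_smul_of_isCoboundary {s r : k}
    (h : IsCoboundary k (s • ((ιU (B 0) : U) ⊗ₜ[k] y) + r • (x ⊗ₜ[k] (ιU (B 0) : U)))) :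
    s • y = r • x := by
  refine (pbwBasis hB).ext_elem fun q => ?_
  have hrepr := repr_twistedTensor hB s r 0 (x := x) (y := y)
  simp only [zero_smul, add_zero, zero_mul] at hrepr
  rw [map_smul, map_smul, Finsupp.smul_apply, Finsupp.smul_apply, smul_eq_mul, smul_eq_mul]
  by_cases hq : q = (1, 0)
  · have hdiag := h.repr_self_eq_zero hB (p := (1, 0)) (by decide)
    rw [hrepr, if_pos rfl, one_mul, mul_one] at hdiag
    rw [hq, ← neg_eq_of_charTwo k (r * _)]
    exact eq_neg_of_add_eq_zero_left hdiag
  · have hsymm := h.repr_symm hB (1, 0) q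
    rw [hrepr, hrepr] at hsymm
    simpa [hq] using hsymm

include hB in
theorem eq_zero_or_eq_zero_of_isCoboundary (hx : IsSkewPrimitive k 1 1 x) {l : k} (hl : l ≠ 0)
    (h : IsCoboundary k (l • (x ⊗ₜ[k] y))) : x = 0 ∨ y = 0 := by
  have hrepr := repr_twistedTensor hB 0 0 l (x := x) (y := y)
  simp only [zero_smul, zero_add, zero_mul] at hrepr
  have hXY : ⇑((pbwBasis hB).repr x) = 0 ∨ ⇑((pbwBasis hB).repr y) = 0 := by
    refine eq_zero_or_eq_zero_of_mul_symm (fun p q => mul_left_cancel₀ hl ?_)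
      fun p => (mul_eq_zero.mp ?_).resolve_left hl
    · rw [← hrepr, ← hrepr, h.repr_symm hB]
    · by_cases hp : p = 0
      · rw [hp, repr_zero_of_isSkewPrimitive hB hx, zero_mul, mul_zero]
      · rw [← hrepr, h.repr_self_eq_zero hB hp]
  exact hXY.imp (fun hX => (pbwBasis hB).ext_elem fun p => by rw [hX, map_zero]; rfl)
    fun hY => (pbwBasis hB).ext_elem fun p => by rw [hY, map_zero]; rfl

section Twisted

variable {l : k} (hl : l ≠ 0) (h : IsCoboundary k
  (coeffsA hB x 0 • (UniversalEnvelopingAlgebra.ι k (B 0) ⊗ₜ[k] y) +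
    coeffsA hB y 0 • (x ⊗ₜ[k] UniversalEnvelopingAlgebra.ι k (B 0)) + l • (x ⊗ₜ[k] y)))

include hl h

theorem eq_smul_or_eq_smul_of_isCoboundary (hx : IsSkewPrimitive k 1 1 x) :
    x = coeffsA hB x 0 • (ιU (B 0) : U) ∨ y = coeffsA hB y 0 • (ιU (B 0) : U) := by
  let X (p : {p : ℕ × ℕ // p ≠ (1, 0)}) := (pbwBasis hB).repr x p
  let Y (p : {p : ℕ × ℕ // p ≠ (1, 0)}) := (pbwBasis hB).repr y p
  have hXY : X = 0 ∨ Y = 0 := by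
    refine eq_zero_or_eq_zero_of_mul_symm (fun p q => mul_left_cancel₀ hl ?_)
      fun p => (mul_eq_zero.mp ?_).resolve_left hl
    · have hsymm := h.repr_symm hB p q
      rw [repr_twistedTensor, repr_twistedTensor] at hsymm
      simpa [p.2, q.2] using hsymm
    · by_cases hp : p.1 = 0
      · simp [X, hp, repr_zero_of_isSkewPrimitive hB hx]
      · have hdiag := h.repr_self_eq_zero hB hp
        rw [repr_twistedTensor] at hdiag
        simpa [p.2] using hdiag
  exact hXY.imp (fun hX => eq_smul_ι_zero_of_repr_eq_zero hB fun p hp => congrFun hX ⟨p, hp⟩)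
    fun hY => eq_smul_ι_zero_of_repr_eq_zero hB fun p hp => congrFun hY ⟨p, hp⟩

theorem coeffsA_zero_mul_eq_zero_of_isCoboundary : coeffsA hB x 0 * coeffsA hB y 0 = 0 := by
  have hdiag := h.repr_self_eq_zero hB (p := (1, 0)) (by decide)
  rw [repr_twistedTensor, if_pos rfl, one_mul, mul_one, ← coeffsA_zero, ← coeffsA_zero,
    mul_comm (coeffsA hB y 0), add_self_eq_zero_of_charTwo k, zero_add] at hdiag
  exact (mul_eq_zero.mp hdiag).resolve_left hl

omit hl [CharP k 2] in
theorem add_one_smul_eq_of_isCoboundary :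
    (l + 1) • coeffsA hB x 0 • y = (l + 1) • coeffsA hB y 0 • x := by
  refine (pbwBasis hB).ext_elem fun q => ?_
  have hsymm := h.repr_symm hB (1, 0) q
  rw [repr_twistedTensor, repr_twistedTensor, if_pos rfl, ← coeffsA_zero, ← coeffsA_zero] at hsymm
  simp only [map_smul, Finsupp.smul_apply, smul_eq_mul]
  linear_combination hsymm

theorem eq_one_and_eq_smul_of_isCoboundary (hx : IsSkewPrimitive k 1 1 x) (hx0 : x ≠ 0)
    (hy0 : y ≠ 0) :
    l = 1 ∧ ((x = coeffsA hB x 0 • (ιU (B 0) : U) ∧ coeffsA hB y 0 = 0) ∨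
      (coeffsA hB x 0 = 0 ∧ y = coeffsA hB y 0 • (ιU (B 0) : U))) := by
  have hmul := mul_eq_zero.mp (coeffsA_zero_mul_eq_zero_of_isCoboundary hB hl h)
  have hsmul := add_one_smul_eq_of_isCoboundary hB h
  have hl1 {s : k} {w : U} (hs : s ≠ 0) (hw : w ≠ 0) (hz : (l + 1) • s • w = 0) : l = 1 := by
    rw [smul_eq_zero, smul_eq_zero, or_iff_left (not_or.mpr ⟨hs, hw⟩)] at hz
    rw [eq_neg_of_add_eq_zero_left hz, neg_eq_of_charTwo k]
  rcases eq_smul_or_eq_smul_of_isCoboundary hB hl h hx with hxa | hya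
  · have hα : coeffsA hB x 0 ≠ 0 := fun h0 => hx0 (by rw [hxa, h0, zero_smul])
    have hβ := hmul.resolve_left hα
    rw [hβ, zero_smul, smul_zero] at hsmul
    exact ⟨hl1 hα hy0 hsmul, Or.inl ⟨hxa, hβ⟩⟩
  · have hβ : coeffsA hB y 0 ≠ 0 := fun h0 => hy0 (by rw [hya, h0, zero_smul])
    have hα := hmul.resolve_right hβ
    rw [hα, zero_smul, smul_zero] at hsmul
    exact ⟨hl1 hβ hx0 hsmul.symm, Or.inr ⟨hα, hya⟩⟩

end Twisted

end Coboundary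

end TwoDimEnveloping

/-! ### Ore extensions -/

namespace OreExtension

variable {k : Type u} {A : Type v} [CommRing k] [Ring A] [Algebra k A]
  {τ : A →ₐ[k] A} {δ : A →ₗ[k] A}

theorem z_mul_of (a : A) : z τ δ * of τ δ a = of τ δ (τ a) * z τ δ + of τ δ (δ a) := by
  have h := mk_rel τ δ (Rel.ore a)
  rwa [map_mul, map_add, map_mul] at h

section Lift

variable {H : Type w} [Ring H] [Algebra k H] (f : A →ₐ[k] H) (ζ : H)

/-- The universal property of an Ore extension. -/
def lift (h : ∀ a, ζ * f a = f (τ a) * ζ + f (δ a)) : OreExtension τ δ →ₐ[k] H :=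
  RingQuot.liftAlgHom k ⟨FreeAlgebra.lift k fun o => o.elim ζ f, by
    rintro _ _ (⟨a, b⟩ | ⟨a, b⟩ | ⟨c⟩ | ⟨a⟩) <;> simp [h]⟩

variable (h : ∀ a, ζ * f a = f (τ a) * ζ + f (δ a))

@[simp]
theorem lift_of (a : A) : lift f ζ h (of τ δ a) = f a := by
  change RingQuot.liftAlgHom k _ (RingQuot.mkAlgHom k _ _) = _
  rw [RingQuot.liftAlgHom_mkAlgHom_apply, FreeAlgebra.lift_ι_apply]
  rfl

@[simp]
theorem lift_z : lift f ζ h (z τ δ) = ζ := by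
  change RingQuot.liftAlgHom k _ (RingQuot.mkAlgHom k _ _) = _
  rw [RingQuot.liftAlgHom_mkAlgHom_apply, FreeAlgebra.lift_ι_apply]
  rfl

theorem hom_ext {F G : OreExtension τ δ →ₐ[k] H} (h : ∀ a, F (of τ δ a) = G (of τ δ a))
    (hz : F (z τ δ) = G (z τ δ)) : F = G := by
  refine RingQuot.ringQuot_ext' k F G (FreeAlgebra.hom_ext ?_)
  funext o
  cases o with
  | none => exact hz
  | some a => exact h a

end Lift

/-- The derivation after the change of variable `z ↦ z + c`. -/
def translateδ (τ : A →ₐ[k] A) (δ : A →ₗ[k] A) (c : A) : A →ₗ[k] A :=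
  δ + LinearMap.mulLeft k c - LinearMap.mulRight k c ∘ₗ τ.toLinearMap

theorem translateδ_apply (c a : A) : translateδ τ δ c a = δ a + c * a - τ a * c := rfl

/-- The change of variable `z ↦ z + c`. -/
def translate (τ : A →ₐ[k] A) (δ : A →ₗ[k] A) (c : A) :
    OreExtension τ (translateδ τ δ c) ≃ₐ[k] OreExtension τ δ :=
  AlgEquiv.ofAlgHom
    (lift (of τ δ) (z τ δ + of τ δ c) fun a => by
      rw [translateδ_apply, map_sub, map_add, map_mul, map_mul, add_mul, z_mul_of, mul_add]
      abel)
    (lift (of τ _) (z τ _ - of τ _ c) fun a => by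
      have hδ : δ a = translateδ τ δ c a - c * a + τ a * c := by rw [translateδ_apply]; abel
      rw [hδ, map_add, map_sub, map_mul, map_mul, sub_mul, z_mul_of, mul_sub]
      abel)
    (hom_ext (fun a => by simp) (by simp))
    (hom_ext (fun a => by simp) (by simp))

@[simp]
theorem translate_of (c a : A) : translate τ δ c (of τ _ a) = of τ δ a :=
  lift_of _ _ _ _

@[simp]
theorem translate_z (c : A) : translate τ δ c (z τ _) = z τ δ + of τ δ c :=
  lift_z _ _ _

section Truncation

variable (hδ : ∀ a b, δ (a * b) = τ a * δ b + δ a * b)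

/-- The action of `A[z; τ, δ]` on its quotient by the left ideal generated by `z ^ 2`, in the
coordinates given by `1` and `z`. -/
def truncRep : OreExtension τ δ →ₐ[k] Module.End k (A × A) :=
  lift (Algebra.lsmul k k (A × A))
    (LinearMap.prod (δ ∘ₗ LinearMap.fst k A A)
      (τ.toLinearMap ∘ₗ LinearMap.fst k A A + δ ∘ₗ LinearMap.snd k A A))
    fun a => LinearMap.ext fun m => Prod.ext (by simp [hδ]) (by simp [hδ, mul_add, add_assoc])

/-- The coordinates of an element of `A[z; τ, δ]` at `1` and `z`. -/
def trunc : OreExtension τ δ →ₗ[k] A × A :=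
  LinearMap.applyₗ ((1, 0) : A × A) ∘ₗ (truncRep hδ).toLinearMap

theorem trunc_of (a : A) : trunc hδ (of τ δ a) = (a, 0) := by
  simp [trunc, truncRep]

theorem trunc_of_mul_z (a : A) : trunc hδ (of τ δ a * z τ δ) = (0, a) := by
  have h1 : δ 1 = 0 := by simpa using hδ 1 1
  simp [trunc, truncRep, h1]

end Truncation

end OreExtension

/-! ### Low coefficients in a generalized Hopf-Ore extension -/

theorem assoc_map_map_comul {R C M₁ M₂ M₃ : Type*} [CommSemiring R] [AddCommMonoid C] [Module R C]
    [Coalgebra R C] [AddCommMonoid M₁] [Module R M₁] [AddCommMonoid M₂] [Module R M₂]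
    [AddCommMonoid M₃] [Module R M₃] (f₁ : C →ₗ[R] M₁) (f₂ : C →ₗ[R] M₂) (f₃ : C →ₗ[R] M₃)
    (c : C) :
    TensorProduct.assoc R M₁ M₂ M₃ (TensorProduct.map
        (TensorProduct.map f₁ f₂ ∘ₗ Coalgebra.comul) f₃ (Coalgebra.comul (R := R) c)) =
      TensorProduct.map f₁ (TensorProduct.map f₂ f₃ ∘ₗ Coalgebra.comul)
        (Coalgebra.comul (R := R) c) := by
  have h := congrArg (TensorProduct.map f₁ (TensorProduct.map f₂ f₃))
    (Coalgebra.coassoc_apply (R := R) c)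
  rw [TensorProduct.map_map_assoc, LinearMap.rTensor, LinearMap.lTensor, TensorProduct.map_map,
    TensorProduct.map_map, LinearMap.comp_id, LinearMap.comp_id] at h
  exact h

namespace GeneralizedHopfOreExtension

variable {k : Type u} [Field k] {A : Type v} [Ring A] [HopfAlgebra k A]
  (E : GeneralizedHopfOreExtension.{u, v, w} k A)

/-- The variable `z` of the extension. -/
def var : E.carrier := E.e (OreExtension.z E.τ E.δ)

/-- The coefficient of `1` in the expansion in powers of the variable. -/
def coeff₀ : E.carrier →ₗ[k] A :=
  LinearMap.fst k A A ∘ₗ OreExtension.trunc E.δ_mul ∘ₗ E.e.symm.toLinearMap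

/-- The coefficient of the variable in the expansion in powers of the variable. -/
def coeff₁ : E.carrier →ₗ[k] A :=
  LinearMap.snd k A A ∘ₗ OreExtension.trunc E.δ_mul ∘ₗ E.e.symm.toLinearMap

theorem incl_apply (a : A) : E.incl a = E.e (OreExtension.of E.τ E.δ a) := rfl

theorem var_mul_incl (a : A) : E.var * E.incl a = E.incl (E.τ a) * E.var + E.incl (E.δ a) := by
  simp only [var, incl_apply]
  rw [← map_mul, OreExtension.z_mul_of, map_add, map_mul]

@[simp] theorem coeff₀_incl (a : A) : E.coeff₀ (E.incl a) = a := by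
  simp [coeff₀, incl_apply, OreExtension.trunc_of]

@[simp] theorem coeff₁_incl (a : A) : E.coeff₁ (E.incl a) = 0 := by
  simp [coeff₁, incl_apply, OreExtension.trunc_of]

@[simp] theorem coeff₀_incl_mul_incl (a b : A) : E.coeff₀ (E.incl a * E.incl b) = a * b := by
  rw [← map_mul, coeff₀_incl]

@[simp] theorem coeff₁_incl_mul_incl (a b : A) : E.coeff₁ (E.incl a * E.incl b) = 0 := by
  rw [← map_mul, coeff₁_incl]

@[simp] theorem coeff₀_incl_mul_var (a : A) : E.coeff₀ (E.incl a * E.var) = 0 := by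
  simp [coeff₀, incl_apply, var, ← map_mul, OreExtension.trunc_of_mul_z]

@[simp] theorem coeff₁_incl_mul_var (a : A) : E.coeff₁ (E.incl a * E.var) = a := by
  simp [coeff₁, incl_apply, var, ← map_mul, OreExtension.trunc_of_mul_z]

@[simp] theorem coeff₀_var : E.coeff₀ E.var = 0 := by
  simpa using E.coeff₀_incl_mul_var 1

@[simp] theorem coeff₁_var : E.coeff₁ E.var = 1 := by
  simpa using E.coeff₁_incl_mul_var 1

@[simp] theorem coeff₀_var_mul_incl (a : A) : E.coeff₀ (E.var * E.incl a) = E.δ a := by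
  rw [var_mul_incl, map_add, coeff₀_incl_mul_var, coeff₀_incl, zero_add]

@[simp] theorem coeff₁_var_mul_incl (a : A) : E.coeff₁ (E.var * E.incl a) = E.τ a := by
  rw [var_mul_incl, map_add, coeff₁_incl_mul_var, coeff₁_incl, add_zero]

theorem coeff₀_comp_incl : E.coeff₀ ∘ₗ E.incl.toLinearMap = LinearMap.id :=
  LinearMap.ext E.coeff₀_incl

theorem coeff₁_comp_incl : E.coeff₁ ∘ₗ E.incl.toLinearMap = 0 :=
  LinearMap.ext E.coeff₁_incl

theorem counit_incl (a : A) :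
    Coalgebra.counit (R := k) (E.incl a) = Coalgebra.counit (R := k) a :=
  E.counit_of a

theorem comul_incl (a : A) : Coalgebra.comul (R := k) (E.incl a) =
    TensorProduct.map E.incl.toLinearMap E.incl.toLinearMap (Coalgebra.comul (R := k) a) :=
  E.comul_of a

theorem comul_var : Coalgebra.comul (R := k) E.var =
    E.var ⊗ₜ[k] E.incl E.r₁ + E.incl E.x ⊗ₜ[k] E.incl E.y + E.incl E.r₂ ⊗ₜ[k] E.var :=
  E.comul_z

@[simp] theorem map_coeff₀_coeff₀_comul_incl (a : A) :
    TensorProduct.map E.coeff₀ E.coeff₀ (Coalgebra.comul (R := k) (E.incl a)) =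
      Coalgebra.comul (R := k) a := by
  rw [comul_incl, TensorProduct.map_map, coeff₀_comp_incl, TensorProduct.map_id,
    LinearMap.id_apply]

@[simp] theorem map_coeff₁_coeff₀_comul_incl (a : A) :
    TensorProduct.map E.coeff₁ E.coeff₀ (Coalgebra.comul (R := k) (E.incl a)) = 0 := by
  rw [comul_incl, TensorProduct.map_map, coeff₁_comp_incl, TensorProduct.map_zero_left,
    LinearMap.zero_apply]

@[simp] theorem map_coeff₀_coeff₁_comul_incl (a : A) :
    TensorProduct.map E.coeff₀ E.coeff₁ (Coalgebra.comul (R := k) (E.incl a)) = 0 := by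
  rw [comul_incl, TensorProduct.map_map, coeff₁_comp_incl, TensorProduct.map_zero_right,
    LinearMap.zero_apply]

theorem counit_r₁ : Coalgebra.counit (R := k) E.r₁ = 1 := by
  have h := congrArg (fun t => Coalgebra.counit (R := k) (E.coeff₁ (TensorProduct.rid k _ t)))
    (Coalgebra.lTensor_counit_comul (R := k) E.var)
  simpa [comul_var, counit_incl] using h

theorem counit_r₂ : Coalgebra.counit (R := k) E.r₂ = 1 := by
  have h := congrArg (fun t => Coalgebra.counit (R := k) (E.coeff₁ (TensorProduct.lid k _ t)))
    (Coalgebra.rTensor_counit_comul (R := k) E.var)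
  simpa [comul_var, counit_incl] using h

theorem isGroupLikeElem_r₁ : IsGroupLikeElem k E.r₁ := by
  refine ⟨E.counit_r₁, ?_⟩
  have h := assoc_map_map_comul E.coeff₁ E.coeff₀ E.coeff₀ E.var
  simp only [comul_var, map_add, TensorProduct.map_tmul, LinearMap.comp_apply,
    map_coeff₀_coeff₀_comul_incl, map_coeff₁_coeff₀_comul_incl, coeff₀_var, coeff₁_var, coeff₀_incl,
    coeff₁_incl, TensorProduct.zero_tmul, TensorProduct.tmul_zero, add_zero,
    TensorProduct.assoc_tmul] at h
  simpa using congrArg (fun t => TensorProduct.lid k _ (LinearMap.rTensor _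
    (Coalgebra.counit (R := k) (A := A)) t)) h.symm

theorem isGroupLikeElem_r₂ : IsGroupLikeElem k E.r₂ := by
  refine ⟨E.counit_r₂, ?_⟩
  have h := assoc_map_map_comul E.coeff₀ E.coeff₀ E.coeff₁ E.var
  simp only [comul_var, map_add, TensorProduct.map_tmul, LinearMap.comp_apply,
    map_coeff₀_coeff₀_comul_incl, map_coeff₀_coeff₁_comul_incl, coeff₀_var, coeff₁_var, coeff₀_incl,
    coeff₁_incl, TensorProduct.zero_tmul, TensorProduct.tmul_zero, add_zero, zero_add,
    ← TensorProduct.assoc_tmul, (TensorProduct.assoc k A A A).injective.eq_iff] at h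
  simpa using congrArg (fun t => TensorProduct.rid k _ (LinearMap.lTensor _
    (Coalgebra.counit (R := k) (A := A)) t)) h

theorem coassoc_x_tmul_y :
    E.x ⊗ₜ[k] (E.y ⊗ₜ[k] E.r₁) +
      TensorProduct.assoc k _ _ _ (Coalgebra.comul (R := k) E.x ⊗ₜ[k] E.y) =
    E.x ⊗ₜ[k] Coalgebra.comul (R := k) E.y + E.r₂ ⊗ₜ[k] (E.x ⊗ₜ[k] E.y) := by
  have h := assoc_map_map_comul E.coeff₀ E.coeff₀ E.coeff₀ E.var
  simpa only [comul_var, map_add, TensorProduct.map_tmul, LinearMap.comp_apply,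
    map_coeff₀_coeff₀_comul_incl, coeff₀_var, coeff₀_incl, TensorProduct.zero_tmul,
    TensorProduct.tmul_zero, add_zero, zero_add, TensorProduct.assoc_tmul] using h

/-! ### The twist and the derivation of a generalized Hopf-Ore extension -/

theorem comul_var_mul_comul_incl (a : A) :
    Coalgebra.comul (R := k) E.var * Coalgebra.comul (R := k) (E.incl a) =
      Coalgebra.comul (R := k) (E.incl (E.τ a)) * Coalgebra.comul (R := k) E.var +
        Coalgebra.comul (R := k) (E.incl (E.δ a)) := by
  rw [← Bialgebra.comul_mul, var_mul_incl, map_add, Bialgebra.comul_mul]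

theorem comul_τ_mul (a : A) :
    Coalgebra.comul (R := k) (E.τ a) * ((1 : A) ⊗ₜ[k] E.r₁) =
      TensorProduct.map E.τ.toLinearMap (LinearMap.mulLeft k E.r₁)
        (Coalgebra.comul (R := k) a) := by
  have hleft (t : A ⊗[k] A) : TensorProduct.map E.coeff₁ E.coeff₀ (Coalgebra.comul (R := k) E.var *
      TensorProduct.map E.incl.toLinearMap E.incl.toLinearMap t) =
      TensorProduct.map E.τ.toLinearMap (LinearMap.mulLeft k E.r₁) t := by
    induction t using TensorProduct.induction_on with
    | zero => simp
    | add p q hp hq => rw [map_add, mul_add, map_add, hp, hq, map_add]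
    | tmul p q => simp [comul_var, add_mul]
  have hright (t : A ⊗[k] A) : TensorProduct.map E.coeff₁ E.coeff₀
      (TensorProduct.map E.incl.toLinearMap E.incl.toLinearMap t * Coalgebra.comul (R := k) E.var) =
      t * ((1 : A) ⊗ₜ[k] E.r₁) := by
    induction t using TensorProduct.induction_on with
    | zero => simp
    | add p q hp hq => rw [map_add, add_mul, map_add, hp, hq, add_mul]
    | tmul p q => simp [comul_var, mul_add]
  have h := congrArg (TensorProduct.map E.coeff₁ E.coeff₀) (E.comul_var_mul_comul_incl a)
  rw [map_add, map_coeff₁_coeff₀_comul_incl, add_zero, comul_incl, comul_incl, hleft, hright] at h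
  exact h.symm

theorem comul_δ (a : A) :
    Coalgebra.comul (R := k) (E.τ a) * (E.x ⊗ₜ[k] E.y) + Coalgebra.comul (R := k) (E.δ a) =
      TensorProduct.map E.δ (LinearMap.mulLeft k E.r₁) (Coalgebra.comul (R := k) a) +
        (E.x ⊗ₜ[k] E.y) * Coalgebra.comul (R := k) a +
        TensorProduct.map (LinearMap.mulLeft k E.r₂) E.δ (Coalgebra.comul (R := k) a) := by
  have hleft (t : A ⊗[k] A) : TensorProduct.map E.coeff₀ E.coeff₀ (Coalgebra.comul (R := k) E.var *
      TensorProduct.map E.incl.toLinearMap E.incl.toLinearMap t) =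
      TensorProduct.map E.δ (LinearMap.mulLeft k E.r₁) t + (E.x ⊗ₜ[k] E.y) * t +
        TensorProduct.map (LinearMap.mulLeft k E.r₂) E.δ t := by
    induction t using TensorProduct.induction_on with
    | zero => simp
    | add p q hp hq => simp only [map_add, mul_add, hp, hq]; abel
    | tmul p q => simp [comul_var, add_mul]
  have hright (t : A ⊗[k] A) : TensorProduct.map E.coeff₀ E.coeff₀
      (TensorProduct.map E.incl.toLinearMap E.incl.toLinearMap t * Coalgebra.comul (R := k) E.var) =
      t * (E.x ⊗ₜ[k] E.y) := by
    induction t using TensorProduct.induction_on with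
    | zero => simp
    | add p q hp hq => rw [map_add, add_mul, map_add, hp, hq, add_mul]
    | tmul p q => simp [comul_var, mul_add]
  have h := congrArg (TensorProduct.map E.coeff₀ E.coeff₀) (E.comul_var_mul_comul_incl a)
  rw [map_add, map_coeff₀_coeff₀_comul_incl, comul_incl, comul_incl, hleft, hright] at h
  exact h.symm

/-- The character `χ = ε ∘ τ`, for which `τ(a) = ∑ χ(a₁) r₁ a₂ r₁⁻¹`. -/
def character : A →ₐ[k] k := (Bialgebra.counitAlgHom k A).comp E.τ

theorem τ_eq_characterTwist (a : A) : E.τ a = characterTwist E.character E.r₁ a := by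
  have hlid (t : A ⊗[k] A) (r : A) : TensorProduct.lid k A (LinearMap.rTensor A Coalgebra.counit
      (t * ((1 : A) ⊗ₜ[k] r))) =
        TensorProduct.lid k A (LinearMap.rTensor A Coalgebra.counit t) * r := by
    induction t using TensorProduct.induction_on with
    | zero => simp
    | add p q hp hq => simp only [add_mul, map_add, hp, hq]
    | tmul p q => simp
  have hmul : E.τ a * E.r₁ = TensorProduct.lid k A (TensorProduct.map E.character.toLinearMap
      (LinearMap.mulLeft k E.r₁) (Coalgebra.comul (R := k) a)) := by
    have h := congrArg (fun t => TensorProduct.lid k A (LinearMap.rTensor A Coalgebra.counit t))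
      (E.comul_τ_mul a)
    rw [hlid, Coalgebra.rTensor_counit_comul, TensorProduct.lid_tmul, one_smul,
      LinearMap.rTensor, TensorProduct.map_map] at h
    exact h
  have hmulRight (t : A ⊗[k] A) (s : A) : TensorProduct.lid k A (TensorProduct.map
      E.character.toLinearMap (LinearMap.mulLeft k E.r₁) t) * s = TensorProduct.lid k A
        (TensorProduct.map E.character.toLinearMap
          (LinearMap.mulRight k s ∘ₗ LinearMap.mulLeft k E.r₁) t) := by
    induction t using TensorProduct.induction_on with
    | zero => simp
    | add p q hp hq => simp only [map_add, add_mul, hp, hq]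
    | tmul p q => simp
  rw [← mul_one (E.τ a), ← E.isGroupLikeElem_r₁.mul_antipode_cancel, ← mul_assoc, hmul, hmulRight]
  rfl

theorem IsNormalized.hasForm {E : GeneralizedHopfOreExtension.{u, v, w} k A}
    (hE : E.IsNormalized) : E.HasForm E.character E.r₁ E.r₂ E.x E.y :=
  ⟨rfl, rfl, rfl, rfl, hE, E.τ_eq_characterTwist⟩

section Primitive

variable {E} (h₁ : E.r₁ = 1) {a : A} (ha : IsSkewPrimitive k 1 1 a)

include h₁ ha

theorem τ_of_isSkewPrimitive : E.τ a = a + E.character a • 1 := by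
  rw [τ_eq_characterTwist, h₁, characterTwist, LinearMap.comp_apply, LinearMap.comp_apply, ha]
  simp [add_comm]

theorem comul_δ_of_isSkewPrimitive (h₂ : E.r₂ = 1) : Coalgebra.comul (R := k) (E.δ a) =
    E.δ a ⊗ₜ[k] (1 : A) + (1 : A) ⊗ₜ[k] E.δ a + ((E.x * a - a * E.x) ⊗ₜ[k] E.y +
      E.x ⊗ₜ[k] (E.y * a - a * E.y) - E.character a • E.x ⊗ₜ[k] E.y) := by
  have hδ1 : E.δ 1 = 0 := by simpa using E.δ_mul 1 1
  have h := E.comul_δ a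
  rw [τ_of_isSkewPrimitive h₁ ha, ha, map_add, map_smul, Bialgebra.comul_one, ha, h₁, h₂] at h
  rw [← sub_eq_iff_eq_add'.mpr h.symm]
  simp only [map_add, TensorProduct.map_tmul, add_mul, mul_add, Algebra.TensorProduct.tmul_mul_tmul,
    one_mul, mul_one, smul_mul_assoc, TensorProduct.sub_tmul, TensorProduct.tmul_sub,
    LinearMap.mulLeft_apply, hδ1, TensorProduct.zero_tmul, TensorProduct.tmul_zero]
  abel

end Primitive

end GeneralizedHopfOreExtension

/-! ### Normalization -/

theorem tmul_left_cancel {k : Type u} [Field k] {V : Type v} [AddCommGroup V] [Module k V]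
    {W : Type w} [AddCommGroup W] [Module k W] {x : V} (hx : x ≠ 0) {s s' : W}
    (h : x ⊗ₜ[k] s = x ⊗ₜ[k] s') : s = s' := by
  obtain ⟨f, hf⟩ := Module.Projective.exists_dual_eq_one k hx
  simpa [hf] using congrArg (fun t => TensorProduct.lid k W (LinearMap.rTensor W f t)) h

section Coassociativity

variable {k : Type u} [Field k] {A : Type v} [Ring A] [Bialgebra k A] {r₁ r₂ x y : A}

theorem exists_comul_eq_of_coassoc (hx : x ≠ 0) (hy : y ≠ 0)
    (h : x ⊗ₜ[k] (y ⊗ₜ[k] r₁) +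
      TensorProduct.assoc k _ _ _ (Coalgebra.comul (R := k) x ⊗ₜ[k] y) =
      x ⊗ₜ[k] Coalgebra.comul (R := k) y + r₂ ⊗ₜ[k] (x ⊗ₜ[k] y)) :
    ∃ w : A, Coalgebra.comul (R := k) x = x ⊗ₜ[k] w + r₂ ⊗ₜ[k] x ∧
      Coalgebra.comul (R := k) y = y ⊗ₜ[k] r₁ + w ⊗ₜ[k] y := by
  obtain ⟨f, hf⟩ := Module.Projective.exists_dual_eq_one k hy
  let F : A ⊗[k] A →ₗ[k] A := (TensorProduct.rid k A).toLinearMap ∘ₗ LinearMap.lTensor A f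
  have hF (t : A ⊗[k] A) :
      LinearMap.lTensor A F (TensorProduct.assoc k _ _ _ (t ⊗ₜ[k] y)) = t := by
    induction t using TensorProduct.induction_on with
    | zero => simp
    | add p q hp hq => simp only [map_add, TensorProduct.add_tmul, hp, hq]
    | tmul p q => simp [F, hf]
  have hFxy : F (x ⊗ₜ[k] y) = x := by simp [F, hf]
  have hΔx : Coalgebra.comul (R := k) x =
      x ⊗ₜ[k] (F (Coalgebra.comul (R := k) y) - F (y ⊗ₜ[k] r₁)) + r₂ ⊗ₜ[k] x := by
    have h' := congrArg (LinearMap.lTensor A F) h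
    rw [map_add, map_add, hF, LinearMap.lTensor_tmul, LinearMap.lTensor_tmul,
      LinearMap.lTensor_tmul, hFxy] at h'
    rw [TensorProduct.tmul_sub, eq_sub_of_add_eq' h']
    abel
  refine ⟨_, hΔx, tmul_left_cancel (k := k) hx ?_⟩
  rw [hΔx, TensorProduct.add_tmul, map_add, TensorProduct.assoc_tmul, TensorProduct.assoc_tmul,
    ← add_assoc, add_left_inj, ← TensorProduct.tmul_add] at h
  exact h.symm

theorem eq_counit_smul_of_comul_eq_self_tmul (h : Coalgebra.comul (R := k) x = x ⊗ₜ[k] r₁) :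
    x = Coalgebra.counit (R := k) x • r₁ := by
  simpa [h] using
    (congrArg (TensorProduct.lid k A) (Coalgebra.rTensor_counit_comul (R := k) x)).symm

theorem eq_counit_smul_of_comul_eq_tmul_self (h : Coalgebra.comul (R := k) x = r₂ ⊗ₜ[k] x) :
    x = Coalgebra.counit (R := k) x • r₂ := by
  simpa [h] using
    (congrArg (TensorProduct.rid k A) (Coalgebra.lTensor_counit_comul (R := k) x)).symm

theorem isGroupLikeElem_of_comul_eq {w : A} (hx : x ≠ 0)
    (hε : Coalgebra.counit (R := k) x = 0)
    (h₂ : Coalgebra.comul (R := k) r₂ = r₂ ⊗ₜ[k] r₂)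
    (h : Coalgebra.comul (R := k) x = x ⊗ₜ[k] w + r₂ ⊗ₜ[k] x) : IsGroupLikeElem k w := by
  constructor
  · have hid := congrArg (TensorProduct.rid k A) (Coalgebra.lTensor_counit_comul (R := k) x)
    rw [h] at hid
    simp only [map_add, LinearMap.lTensor_tmul, TensorProduct.rid_tmul, hε, zero_smul, add_zero,
      one_smul] at hid
    exact smul_left_injective k hx (hid.trans (one_smul k x).symm)
  · have hco := Coalgebra.coassoc_apply (R := k) x
    rw [h] at hco
    simp only [map_add, LinearMap.rTensor_tmul, LinearMap.lTensor_tmul, h, h₂,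
      TensorProduct.add_tmul, TensorProduct.tmul_add, TensorProduct.assoc_tmul, add_assoc,
      add_left_inj] at hco
    exact (tmul_left_cancel hx hco).symm

theorem exists_coboundary_or_isGroupLikeElem (h₁ : IsGroupLikeElem k r₁)
    (h₂ : IsGroupLikeElem k r₂)
    (h : x ⊗ₜ[k] (y ⊗ₜ[k] r₁) +
      TensorProduct.assoc k _ _ _ (Coalgebra.comul (R := k) x ⊗ₜ[k] y) =
      x ⊗ₜ[k] Coalgebra.comul (R := k) y + r₂ ⊗ₜ[k] (x ⊗ₜ[k] y)) :
    (∃ c : A, x ⊗ₜ[k] y + Coalgebra.comul (R := k) c = c ⊗ₜ[k] r₁ + r₂ ⊗ₜ[k] c) ∨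
      x ≠ 0 ∧ y ≠ 0 ∧ ∃ w : A, IsGroupLikeElem k w ∧
        Coalgebra.comul (R := k) x = x ⊗ₜ[k] w + r₂ ⊗ₜ[k] x ∧
        Coalgebra.comul (R := k) y = y ⊗ₜ[k] r₁ + w ⊗ₜ[k] y := by
  by_cases hx : x = 0
  · exact Or.inl ⟨0, by simp [hx]⟩
  by_cases hy : y = 0
  · exact Or.inl ⟨0, by simp [hy]⟩
  obtain ⟨w, hΔx, hΔy⟩ := exists_comul_eq_of_coassoc hx hy h
  by_cases hε : Coalgebra.counit (R := k) x = 0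
  · exact Or.inr ⟨hx, hy, w, isGroupLikeElem_of_comul_eq hx hε h₂.comul_eq_tmul_self hΔx, hΔx, hΔy⟩
  have hw : w = 0 := by
    have hid := congrArg (TensorProduct.lid k A) (Coalgebra.rTensor_counit_comul (R := k) x)
    simpa [hΔx, hε, h₂.counit_eq_one] using hid
  rw [hw, TensorProduct.tmul_zero, zero_add] at hΔx
  rw [hw, TensorProduct.zero_tmul, add_zero] at hΔy
  -- Now `x ⊗ y` is a multiple of `r₂ ⊗ r₁`, where `r₁` and `r₂` are group-like.
  refine Or.inl ⟨(Coalgebra.counit (R := k) x * Coalgebra.counit (R := k) y) • r₁, ?_⟩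
  nth_rw 1 [eq_counit_smul_of_comul_eq_tmul_self hΔx, eq_counit_smul_of_comul_eq_self_tmul hΔy]
  rw [map_smul, h₁.comul_eq_tmul_self, TensorProduct.smul_tmul_smul, TensorProduct.tmul_smul,
    ← TensorProduct.smul_tmul', add_comm]

end Coassociativity

namespace GeneralizedHopfOreExtension

variable {k : Type u} [Field k] {A : Type v} [Ring A] [HopfAlgebra k A]
  (E : GeneralizedHopfOreExtension.{u, v, w} k A)

theorem isomorphic_refl : E.Isomorphic E :=
  ⟨BialgEquiv.refl k E.carrier, Set.image_id _⟩

section RemoveCoboundary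

variable (c : A)
  (h : E.x ⊗ₜ[k] E.y + Coalgebra.comul (R := k) c = c ⊗ₜ[k] E.r₁ + E.r₂ ⊗ₜ[k] c)

theorem translate_trans_comp_of :
    ((OreExtension.translate E.τ E.δ c).trans E.e).toAlgHom.comp (OreExtension.of E.τ _) =
      E.incl :=
  AlgHom.ext fun _ => congrArg E.e (OreExtension.translate_of _ _)

/-- The extension obtained by the change of variable `z ↦ z + c`, where `c` is chosen so that
`x ⊗ y` becomes `0`. -/
def removeCoboundary : GeneralizedHopfOreExtension.{u, v, w} k A where
  τ := E.τ
  δ := OreExtension.translateδ E.τ E.δ c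
  δ_mul a b := by
    simp only [OreExtension.translateδ_apply, map_mul, E.δ_mul]
    noncomm_ring
  carrier := E.carrier
  e := (OreExtension.translate E.τ E.δ c).trans E.e
  r₁ := E.r₁
  r₂ := E.r₂
  x := 0
  y := 0
  counit_of a := by
    rw [AlgEquiv.trans_apply, OreExtension.translate_of]
    exact E.counit_of a
  comul_of a := by
    rw [translate_trans_comp_of, AlgEquiv.trans_apply, OreExtension.translate_of]
    exact E.comul_of a
  comul_z := by
    have h' := congrArg (TensorProduct.map E.incl.toLinearMap E.incl.toLinearMap) h
    simp only [map_add, TensorProduct.map_tmul, ← E.comul_incl, AlgHom.toLinearMap_apply] at h'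
    simp only [AlgEquiv.trans_apply, OreExtension.translate_of, OreExtension.translate_z]
    rw [map_add E.e, map_add (Coalgebra.comul (R := k)), map_zero, map_zero,
      TensorProduct.tmul_zero, add_zero, TensorProduct.add_tmul, TensorProduct.tmul_add]
    change Coalgebra.comul (R := k) E.var + Coalgebra.comul (R := k) (E.incl c) =
      E.var ⊗ₜ[k] E.incl E.r₁ + E.incl c ⊗ₜ[k] E.incl E.r₁ +
        (E.incl E.r₂ ⊗ₜ[k] E.var + E.incl E.r₂ ⊗ₜ[k] E.incl c)
    rw [comul_var, add_right_comm, add_assoc (E.var ⊗ₜ[k] _), h']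
    abel

theorem isomorphic_removeCoboundary : E.Isomorphic (E.removeCoboundary c h) := by
  have hc : (E.removeCoboundary c h).incl = E.incl := E.translate_trans_comp_of c
  exact ⟨BialgEquiv.refl k E.carrier, by rw [hc]; exact Set.image_id _⟩

end RemoveCoboundary

theorem exists_isomorphic_isNormalized (hG : ∀ w : A, IsGroupLikeElem k w → w = 1) :
    ∃ E' : GeneralizedHopfOreExtension.{u, v, w} k A, E.Isomorphic E' ∧ E'.IsNormalized := by
  obtain ⟨c, hc⟩ | ⟨hx, hy, w, hw, hΔx, hΔy⟩ := exists_coboundary_or_isGroupLikeElem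
    E.isGroupLikeElem_r₁ E.isGroupLikeElem_r₂ E.coassoc_x_tmul_y
  · exact ⟨E.removeCoboundary c hc, E.isomorphic_removeCoboundary c hc,
      E.isGroupLikeElem_r₁, E.isGroupLikeElem_r₂, by simp [IsSkewPrimitive, removeCoboundary],
      by simp [IsSkewPrimitive, removeCoboundary], by simp [removeCoboundary]⟩
  · rw [hG w hw] at hΔx hΔy
    exact ⟨E, E.isomorphic_refl, E.isGroupLikeElem_r₁, E.isGroupLikeElem_r₂, hΔx, hΔy,
      by simp [hx, hy]⟩

end GeneralizedHopfOreExtension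

/-! ### The families -/

theorem eq_smul_of_smul_eq_smul {k : Type u} [Field k] {M : Type v} [AddCommGroup M] [Module k M]
    {a x y : M} {α β : k} (hx : x ≠ 0) (hxa : x = α • a) (h : α • y = β • x) : y = β • a := by
  have hα : α ≠ 0 := fun h0 => hx (by rw [hxa, h0, zero_smul])
  refine smul_right_injective M hα ?_
  dsimp only
  rw [h, smul_comm, ← hxa]

section Enveloping

variable {k : Type u} [Field k] {g : Type v} [LieRing g] [LieAlgebra k g]

local notation "U" => UniversalEnvelopingAlgebra k g
local notation "ιU" => UniversalEnvelopingAlgebra.ι k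

theorem isSkewPrimitive_ι (u : g) : IsSkewPrimitive k 1 1 (ιU u : U) := by
  rw [IsSkewPrimitive, UEAHopf.comul_eq, UEAHopf.comulHom_ι]

theorem algHom_ι_lie {C : Type*} [CommRing C] [Algebra k C] (χ : U →ₐ[k] C) (u v : g) :
    χ (ιU ⁅u, v⁆) = 0 := by
  rw [LieHom.map_lie, LieRing.of_associative_ring_bracket, map_sub, map_mul, map_mul, mul_comm,
    sub_self]

theorem GeneralizedHopfOreExtension.δ_ι_lie
    (E : GeneralizedHopfOreExtension.{u, max u v, w} k (UniversalEnvelopingAlgebra k g))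
    (h₁ : E.r₁ = 1) (u v : g) : E.δ (ιU ⁅u, v⁆) =
      (E.δ (ιU u) * ιU v - ιU v * E.δ (ιU u)) + (ιU u * E.δ (ιU v) - E.δ (ιU v) * ιU u) +
        E.character (ιU u) • E.δ (ιU v) - E.character (ιU v) • E.δ (ιU u) := by
  rw [LieHom.map_lie, LieRing.of_associative_ring_bracket, map_sub, E.δ_mul, E.δ_mul,
    τ_of_isSkewPrimitive h₁ (isSkewPrimitive_ι u), τ_of_isSkewPrimitive h₁ (isSkewPrimitive_ι v),
    add_mul, add_mul, smul_one_mul, smul_one_mul]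
  abel

end Enveloping

namespace TwoDimEnveloping

open HopfOreChar2

variable {k : Type u} [Field k] {g : Type v} [LieRing g] [LieAlgebra k g]

local notation "U" => UniversalEnvelopingAlgebra k g
local notation "ιU" => UniversalEnvelopingAlgebra.ι k

variable {B : Module.Basis (Fin 2) k g} {c : k}
  {E : GeneralizedHopfOreExtension.{u, max u v, w} k (UniversalEnvelopingAlgebra k g)}

theorem δ_ι_mem_restrictedHull {p : ℕ} (ha : E.δ (ιU (B 0)) ∈ restrictedHull k g p)
    (hb : E.δ (ιU (B 1)) ∈ restrictedHull k g p) (u : g) : E.δ (ιU u) ∈ restrictedHull k g p := by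
  rw [eq_smul_add_smul B u]
  simp only [map_add, map_smul]
  exact add_mem (Submodule.smul_mem _ _ ha) (Submodule.smul_mem _ _ hb)

section Normalized

variable (hB : ⁅B 0, B 1⁆ = c • B 0)

include hB

theorem r₁_eq_one : E.r₁ = 1 := eq_one_of_isGroupLikeElem hB E.isGroupLikeElem_r₁

theorem r₂_eq_one : E.r₂ = 1 := eq_one_of_isGroupLikeElem hB E.isGroupLikeElem_r₂

theorem comul_δ_ι (u : g) : Coalgebra.comul (R := k) (E.δ (ιU u)) =
    E.δ (ιU u) ⊗ₜ[k] (1 : U) + (1 : U) ⊗ₜ[k] E.δ (ιU u) +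
      ((E.x * ιU u - ιU u * E.x) ⊗ₜ[k] E.y + E.x ⊗ₜ[k] (E.y * ιU u - ιU u * E.y) -
        E.character (ιU u) • E.x ⊗ₜ[k] E.y) :=
  E.comul_δ_of_isSkewPrimitive (r₁_eq_one hB) (isSkewPrimitive_ι u) (r₂_eq_one hB)

variable (hE : E.IsNormalized)

include hE

theorem hasForm : E.HasForm E.character 1 1 E.x E.y := by
  simpa only [r₁_eq_one hB, r₂_eq_one hB] using hE.hasForm

theorem isSkewPrimitive_x : IsSkewPrimitive k 1 1 E.x := by
  simpa only [r₂_eq_one hB] using hE.primitive_x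

theorem isSkewPrimitive_y : IsSkewPrimitive k 1 1 E.y := by
  simpa only [r₁_eq_one hB] using hE.primitive_y

theorem familyA_of_eq_zero [CharP k 2] (hx : E.x = 0) : FamilyA (B 0) (B 1) E := by
  have hy := hE.x_eq_zero_iff.mp hx
  have h := hasForm hB hE
  rw [hx, hy] at h
  refine ⟨E.character, h, fun u => ?_, E.δ_ι_lie (r₁_eq_one hB) _ _⟩
  refine mem_restrictedHull_of_isSkewPrimitive hB 2 Nat.prime_two ?_
  rw [IsSkewPrimitive, comul_δ_ι hB, hx, hy]
  simp

end Normalized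

variable [CharP k 2] (hE : E.IsNormalized)

include hE

theorem familyB_of_lie_eq_zero (hx : E.x ≠ 0) (hy : E.y ≠ 0) (hB : ⁅B 0, B 1⁆ = 0) :
    FamilyB (B 0) (B 1) E := by
  have hB₀ : ⁅B 0, B 1⁆ = (0 : k) • B 0 := by rw [hB, zero_smul]
  have hcomul (u : g) : Coalgebra.comul (R := k) (E.δ (ιU u)) =
      E.δ (ιU u) ⊗ₜ[k] (1 : U) + (1 : U) ⊗ₜ[k] E.δ (ιU u) +
        (-E.character (ιU u)) • (E.x ⊗ₜ[k] E.y) := by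
    rw [comul_δ_ι hB₀, (commute_ι_of_lie_eq_zero hB E.x u).eq,
      (commute_ι_of_lie_eq_zero hB E.y u).eq]
    simp [TensorProduct.smul_tmul']
  have hχ (u : g) : E.character (ιU u) = 0 := by
    by_contra hu
    exact (eq_zero_or_eq_zero_of_isCoboundary hB₀ (isSkewPrimitive_x hB₀ hE) (neg_ne_zero.mpr hu)
      ⟨_, hcomul u⟩).elim hx hy
  refine ⟨hB, E.character, E.x, E.y, hasForm hB₀ hE, hχ,
    mem_restrictedHull_of_isSkewPrimitive hB₀ 2 Nat.prime_two (isSkewPrimitive_x hB₀ hE),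
    mem_restrictedHull_of_isSkewPrimitive hB₀ 2 Nat.prime_two (isSkewPrimitive_y hB₀ hE),
    hx, hy, fun u => mem_restrictedHull_of_isSkewPrimitive hB₀ 2 Nat.prime_two ?_⟩
  rw [IsSkewPrimitive, hcomul, hχ, neg_zero, zero_smul, add_zero]

section NonAbelian

variable (hB : ⁅B 0, B 1⁆ = (1 : k) • B 0)

include hB

omit [CharP k 2] hE in
theorem character_ι_zero : E.character (ιU (B 0)) = 0 := by
  rw [← one_smul k (B 0), ← hB, algHom_ι_lie]

theorem comul_δ_ι_zero : Coalgebra.comul (R := k) (E.δ (ιU (B 0))) =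
    E.δ (ιU (B 0)) ⊗ₜ[k] (1 : U) + (1 : U) ⊗ₜ[k] E.δ (ιU (B 0)) +
      (coeffSum (coeffsB hB E.x) • ((ιU (B 0) : U) ⊗ₜ[k] E.y) +
        coeffSum (coeffsB hB E.y) • (E.x ⊗ₜ[k] (ιU (B 0) : U))) := by
  rw [comul_δ_ι hB, character_ι_zero hB, zero_smul, sub_zero,
    mul_ι_zero_sub_of_isSkewPrimitive hB (isSkewPrimitive_x hB hE),
    mul_ι_zero_sub_of_isSkewPrimitive hB (isSkewPrimitive_y hB hE), TensorProduct.smul_tmul',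
    TensorProduct.tmul_smul]

theorem comul_δ_ι_one : Coalgebra.comul (R := k) (E.δ (ιU (B 1))) =
    E.δ (ιU (B 1)) ⊗ₜ[k] (1 : U) + (1 : U) ⊗ₜ[k] E.δ (ιU (B 1)) +
      (coeffsA hB E.x 0 • ((ιU (B 0) : U) ⊗ₜ[k] E.y) +
        coeffsA hB E.y 0 • (E.x ⊗ₜ[k] (ιU (B 0) : U)) +
        E.character (ιU (B 1)) • (E.x ⊗ₜ[k] E.y)) := by
  rw [comul_δ_ι hB, mul_ι_one_sub_of_isSkewPrimitive hB (isSkewPrimitive_x hB hE),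
    mul_ι_one_sub_of_isSkewPrimitive hB (isSkewPrimitive_y hB hE), ← TensorProduct.smul_tmul',
    TensorProduct.tmul_smul, sub_eq_add_neg, neg_eq_of_charTwo k]

theorem coeffSum_smul_y_eq :
    coeffSum (coeffsB hB E.x) • E.y = coeffSum (coeffsB hB E.y) • E.x :=
  smul_eq_smul_of_isCoboundary hB ⟨_, comul_δ_ι_zero hE hB⟩



theorem familyC_of_character_eq_zero (hx : E.x ≠ 0) (hy : E.y ≠ 0)
    (hχ : E.character (ιU (B 1)) = 0) : FamilyC (B 0) (B 1) E := by
  have hx' := isSkewPrimitive_x hB hE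
  have hy' := isSkewPrimitive_y hB hE
  have hΔb := comul_δ_ι_one hE hB
  rw [hχ, zero_smul, add_zero] at hΔb
  have h₀ := smul_eq_smul_of_isCoboundary hB ⟨_, hΔb⟩
  have hδa := sub_smul_mul_mem_restrictedHull hB Nat.prime_two hx' (coeffSum_smul_y_eq hE hB)
    (comul_δ_ι_zero hE hB)
  have hδb := sub_smul_mul_mem_restrictedHull hB Nat.prime_two hx' h₀ hΔb
  have hlie := E.δ_ι_lie (r₁_eq_one hB) (B 0) (B 1)
  rw [character_ι_zero hB, hχ, zero_smul, zero_smul, add_zero, sub_zero, hB, one_smul] at hlie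
  refine ⟨by rw [hB, one_smul], E.character, coeffsA hB E.x, coeffsB hB E.x, coeffsA hB E.y,
    coeffsB hB E.y, E.x, E.y, eq_combination_of_isSkewPrimitive hB hx',
    eq_combination_of_isSkewPrimitive hB hy', hasForm hB hE, fun u => ?_, hx, hy, h₀,
    coeffSum_smul_y_eq hE hB, hlie, ?_⟩
  · rw [eq_smul_add_smul B u]
    simp only [map_add, map_smul, character_ι_zero hB, hχ, smul_zero, add_zero]
  by_cases hxa : E.x = coeffsA hB E.x 0 • (ιU (B 0) : U)
  · have hya := eq_smul_of_smul_eq_smul (k := k) hx hxa h₀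
    refine Or.inl ⟨hxa, hya, δ_ι_mem_restrictedHull (B := B) ?_ ?_⟩
    · have hβ' : coeffSum (coeffsB hB E.y) = 0 := by
        rw [hya, coeffSum_coeffsB_smul_ι_zero]
      rwa [hβ', zero_smul, sub_zero] at hδa
    · refine (Submodule.sub_mem_iff_left _ ?_).mp hδb
      rw [hxa, mul_smul_comm]
      exact Submodule.smul_mem _ _ (Submodule.smul_mem _ _
        (Submodule.subset_span ⟨B 0, 1, by rw [pow_one, sq]⟩))
  · exact Or.inr ⟨hxa, hδa, hδb⟩

theorem familyD_of_character_ne_zero (hx : E.x ≠ 0) (hy : E.y ≠ 0)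
    (hχ : E.character (ιU (B 1)) ≠ 0) : FamilyD (B 0) (B 1) E := by
  have hx' := isSkewPrimitive_x hB hE
  have hy' := isSkewPrimitive_y hB hE
  have hΔa := comul_δ_ι_zero hE hB
  have hΔb := comul_δ_ι_one hE hB
  have hα' := coeffSum_smul_y_eq hE hB
  obtain ⟨hχ1, hcases⟩ := eq_one_and_eq_smul_of_isCoboundary hB hχ ⟨_, hΔb⟩ hx' hx hy
  have hlie := E.δ_ι_lie (r₁_eq_one hB) (B 0) (B 1)
  rw [character_ι_zero hB, hχ1, zero_smul, add_zero, hB, one_smul, one_smul, eq_sub_iff_add_eq,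
    add_self_eq_zero_of_charTwo k] at hlie
  have hvanish : coeffSum (coeffsB hB E.x) = 0 ∧ coeffSum (coeffsB hB E.y) = 0 ∧
      coeffsA hB E.x 0 • ((ιU (B 0) : U) ⊗ₜ[k] E.y) +
        coeffsA hB E.y 0 • (E.x ⊗ₜ[k] (ιU (B 0) : U)) = E.x ⊗ₜ[k] E.y := by
    rcases hcases with ⟨hxa, hβ⟩ | ⟨hα, hya⟩
    · have h0 : coeffSum (coeffsB hB E.x) = 0 := by rw [hxa, coeffSum_coeffsB_smul_ι_zero]
      rw [h0, zero_smul, eq_comm, smul_eq_zero, or_iff_left hx] at hα'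
      exact ⟨h0, hα', by rw [hβ, zero_smul, add_zero, TensorProduct.smul_tmul', ← hxa]⟩
    · have h0 : coeffSum (coeffsB hB E.y) = 0 := by rw [hya, coeffSum_coeffsB_smul_ι_zero]
      rw [h0, zero_smul, smul_eq_zero, or_iff_left hy] at hα'
      exact ⟨hα', h0, by rw [hα, zero_smul, zero_add, ← TensorProduct.tmul_smul, ← hya]⟩
  obtain ⟨hα'0, hβ'0, hxy⟩ := hvanish
  rw [hα'0, hβ'0, zero_smul, zero_smul, add_zero, add_zero] at hΔa
  rw [hχ1, one_smul, hxy, add_self_eq_zero_of_charTwo k, add_zero] at hΔb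
  exact ⟨by rw [hB, one_smul], E.character, coeffsA hB E.x, coeffsB hB E.x, coeffsA hB E.y,
    coeffsB hB E.y, E.x, E.y, eq_combination_of_isSkewPrimitive hB hx',
    eq_combination_of_isSkewPrimitive hB hy', hasForm hB hE, character_ι_zero hB, hχ1, hx, hy,
    δ_ι_mem_restrictedHull (mem_restrictedHull_of_isSkewPrimitive hB 2 Nat.prime_two hΔa)
      (mem_restrictedHull_of_isSkewPrimitive hB 2 Nat.prime_two hΔb), hlie.symm,
    hcases.imp (fun h => ⟨h.1, h.2, hβ'0⟩) fun h => ⟨h.1, hα'0, h.2⟩⟩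

end NonAbelian

theorem mem_family_of_isNormalized (hB : ⁅B 0, B 1⁆ = 0 ∨ ⁅B 0, B 1⁆ = B 0) :
    FamilyA (B 0) (B 1) E ∨ FamilyB (B 0) (B 1) E ∨ FamilyC (B 0) (B 1) E ∨
      FamilyD (B 0) (B 1) E := by
  by_cases hx : E.x = 0
  · obtain ⟨c, hc⟩ := exists_lie_eq_smul hB
    exact Or.inl (familyA_of_eq_zero hc hE hx)
  have hy : E.y ≠ 0 := mt hE.x_eq_zero_iff.mpr hx
  rcases hB with hB | hB
  · exact Or.inr (Or.inl (familyB_of_lie_eq_zero hE hx hy hB))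
  have hB₁ : ⁅B 0, B 1⁆ = (1 : k) • B 0 := by rw [hB, one_smul]
  by_cases hχ : E.character (ιU (B 1)) = 0
  · exact Or.inr (Or.inr (Or.inl (familyC_of_character_eq_zero hE hB₁ hx hy hχ)))
  · exact Or.inr (Or.inr (Or.inr (familyD_of_character_ne_zero hE hB₁ hx hy hχ)))

end TwoDimEnveloping

/-! ### Extensions by one variable that are enveloping algebras -/

section Primitive

variable {k : Type u} [Field k] {H : Type w} [Ring H] [HopfAlgebra k H]

theorem IsSkewPrimitive.add {a b : H} (ha : IsSkewPrimitive k 1 1 a)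
    (hb : IsSkewPrimitive k 1 1 b) : IsSkewPrimitive k 1 1 (a + b) := by
  rw [IsSkewPrimitive] at *
  rw [map_add, ha, hb, TensorProduct.add_tmul, TensorProduct.tmul_add, add_add_add_comm]

theorem IsSkewPrimitive.smul {a : H} (ha : IsSkewPrimitive k 1 1 a) (c : k) :
    IsSkewPrimitive k 1 1 (c • a) := by
  rw [IsSkewPrimitive] at *
  rw [map_smul, ha, smul_add, TensorProduct.tmul_smul, TensorProduct.smul_tmul']

theorem IsSkewPrimitive.counit_eq_zero {a : H} (ha : IsSkewPrimitive k 1 1 a) :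
    Coalgebra.counit (R := k) a = 0 := by
  have h := congrArg (TensorProduct.lid k H) (Coalgebra.rTensor_counit_comul (R := k) a)
  rw [ha] at h
  simp only [map_add, LinearMap.rTensor_tmul, TensorProduct.lid_tmul, Bialgebra.counit_one,
    one_smul, add_eq_right] at h
  simpa using congrArg (Coalgebra.counit (R := k)) h

variable {L : Type v} [LieRing L] [LieAlgebra k L]

theorem counitAlgHom_comp_of_isSkewPrimitive {f : UniversalEnvelopingAlgebra k L →ₐ[k] H}
    (hf : ∀ l, IsSkewPrimitive k 1 1 (f (UniversalEnvelopingAlgebra.ι k l))) :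
    (Bialgebra.counitAlgHom k H).comp f =
      Bialgebra.counitAlgHom k (UniversalEnvelopingAlgebra k L) :=
  UEAHopf.algHom_ext fun l =>
    (hf l).counit_eq_zero.trans (isSkewPrimitive_ι l).counit_eq_zero.symm

theorem map_comp_comulAlgHom_of_isSkewPrimitive {f : UniversalEnvelopingAlgebra k L →ₐ[k] H}
    (hf : ∀ l, IsSkewPrimitive k 1 1 (f (UniversalEnvelopingAlgebra.ι k l))) :
    (Algebra.TensorProduct.map f f).comp
        (Bialgebra.comulAlgHom k (UniversalEnvelopingAlgebra k L)) =
      (Bialgebra.comulAlgHom k H).comp f := by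
  refine UEAHopf.algHom_ext fun l => ?_
  change Algebra.TensorProduct.map f f
    (Coalgebra.comul (R := k) (UniversalEnvelopingAlgebra.ι k l)) =
      Coalgebra.comul (R := k) (f (UniversalEnvelopingAlgebra.ι k l))
  rw [hf l, isSkewPrimitive_ι l]
  simp

/-- An algebra isomorphism from an enveloping algebra that sends the generators to primitive
elements, as a bialgebra isomorphism. -/
def bialgEquivOfIsSkewPrimitive (f : UniversalEnvelopingAlgebra k L ≃ₐ[k] H)
    (hf : ∀ l, IsSkewPrimitive k 1 1 (f (UniversalEnvelopingAlgebra.ι k l))) :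
    UniversalEnvelopingAlgebra k L ≃ₐc[k] H :=
  BialgEquiv.ofAlgEquiv f (counitAlgHom_comp_of_isSkewPrimitive (f := f.toAlgHom) hf)
    (map_comp_comulAlgHom_of_isSkewPrimitive (f := f.toAlgHom) hf)

end Primitive

section Affine

variable {k : Type u} [Field k] {g : Type v} [LieRing g] [LieAlgebra k g]
  {L : Type t} [LieRing L] [LieAlgebra k L] {M : Type w} [LieRing M] [LieAlgebra k M]

/-- The linear map `(u, c) ↦ j(u) + c ζ`. -/
def affine (j : g →ₗ⁅k⁆ L) (ζ : L) : g × k →ₗ[k] L :=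
  j.toLinearMap.coprod (LinearMap.toSpanSingleton k L ζ)

theorem affine_apply (j : g →ₗ⁅k⁆ L) (ζ : L) (p : g × k) : affine j ζ p = j p.1 + p.2 • ζ := rfl

variable {d : g → g} {χ : g → k}

theorem lie_affine {j : g →ₗ⁅k⁆ L} {ζ : L} (h : ∀ u, ⁅ζ, j u⁆ = affine j ζ (d u, χ u))
    (p q : g × k) : ⁅affine j ζ p, affine j ζ q⁆ =
      affine j ζ ((⁅p.1, q.1⁆, 0) + p.2 • (d q.1, χ q.1) - q.2 • (d p.1, χ p.1)) := by
  have h' (u : g) : ⁅j u, ζ⁆ = -affine j ζ (d u, χ u) := by rw [← lie_skew, h]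
  rw [map_sub, map_add, map_smul, map_smul, affine_apply, affine_apply, add_lie, lie_add, lie_add,
    smul_lie, smul_lie, lie_smul, lie_smul, lie_self, h, h', affine_apply j ζ (_, 0)]
  simp only [LieHom.map_lie, zero_smul, add_zero, smul_zero, smul_neg, sub_eq_add_neg]
  abel

/-- `L = j(g) ⊕ k ζ` with `j` injective, and `ζ` acts by `[ζ, j(u)] = j(d(u)) + χ(u) ζ`. -/
structure IsCodimOneExtension (j : g →ₗ⁅k⁆ L) (ζ : L) (d : g → g) (χ : g → k) : Prop where
  lie_eq : ∀ u, ⁅ζ, j u⁆ = affine j ζ (d u, χ u)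
  bijective : Function.Bijective (affine j ζ)

theorem exists_isCodimOneExtension {j : g →ₗ⁅k⁆ L} (hj : Function.Injective j)
    (hL : Module.finrank k L = Module.finrank k g + 1) :
    ∃ (ζ : L) (d : g →ₗ[k] g) (χ : g →ₗ[k] k), IsCodimOneExtension j ζ d χ := by
  have : Module.Finite k L := Module.finite_of_finrank_eq_succ hL
  have : Module.Finite k g := Module.Finite.of_injective j.toLinearMap hj
  obtain ⟨ζ, hζ⟩ : ∃ ζ : L, ζ ∉ LinearMap.range j.toLinearMap := by
    by_contra! h
    have hr := LinearMap.finrank_range_of_inj (f := j.toLinearMap) hj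
    rw [Submodule.eq_top_iff'.mpr h, finrank_top] at hr
    omega
  have hinj : Function.Injective (affine j ζ) := by
    refine (injective_iff_map_eq_zero _).mpr fun p hp => ?_
    rw [affine_apply] at hp
    have h₂ : p.2 = 0 := by
      by_contra h₂
      refine hζ ⟨-(p.2)⁻¹ • p.1, ?_⟩
      rw [map_smul, LieHom.coe_toLinearMap, eq_neg_of_add_eq_zero_left hp, neg_smul, smul_neg,
        neg_neg, smul_smul, inv_mul_cancel₀ h₂, one_smul]
    rw [h₂, zero_smul, add_zero] at hp
    exact Prod.ext (hj (by rw [hp, Prod.fst_zero, map_zero])) h₂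
  let Φ := LinearMap.linearEquivOfInjective (affine j ζ) hinj (by
    rw [Module.finrank_prod, Module.finrank_self, hL])
  let D : g →ₗ[k] g × k := Φ.symm.toLinearMap ∘ₗ LieAlgebra.ad k L ζ ∘ₗ j.toLinearMap
  exact ⟨ζ, LinearMap.fst k g k ∘ₗ D, LinearMap.snd k g k ∘ₗ D,
    fun u => (Φ.apply_symm_apply ⁅ζ, j u⁆).symm, Φ.bijective⟩

namespace IsCodimOneExtension

variable {j : g →ₗ⁅k⁆ L} {ζ : L} (h : IsCodimOneExtension j ζ d χ)

include h

theorem injective : Function.Injective j := fun u v huv =>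
  congrArg Prod.fst <| h.bijective.injective (a₁ := (u, 0)) (a₂ := (v, 0)) (by
    rw [affine_apply, affine_apply, huv])

theorem finrank_eq [Module.Finite k g] : Module.finrank k L = Module.finrank k g + 1 := by
  rw [← (LinearEquiv.ofBijective _ h.bijective).finrank_eq, Module.finrank_prod,
    Module.finrank_self]

theorem map_lie (u v : g) : d ⁅u, v⁆ = ⁅d u, v⁆ + ⁅u, d v⁆ + χ u • d v - χ v • d u ∧
    χ ⁅u, v⁆ = 0 := by
  have hj (w : g) : j w = affine j ζ (w, 0) := by rw [affine_apply, zero_smul, add_zero]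
  have hjac : affine j ζ (d ⁅u, v⁆, χ ⁅u, v⁆) =
      affine j ζ (⁅d u, v⁆ + ⁅u, d v⁆ + χ u • d v - χ v • d u, 0) := by
    rw [← h.lie_eq, LieHom.map_lie, leibniz_lie, h.lie_eq, h.lie_eq, hj u, hj v,
      lie_affine h.lie_eq, lie_affine h.lie_eq, ← map_add]
    congr 1
    ext
    · simp
      abel
    · simp [mul_comm]
  exact Prod.mk.inj (h.bijective.injective hjac)

/-- The Lie algebra map out of `L` that extends `i` and takes `ζ` to `ξ`. -/
def lift {i : g →ₗ⁅k⁆ M} {ξ : M} (hξ : ∀ u, ⁅ξ, i u⁆ = affine i ξ (d u, χ u)) : L →ₗ⁅k⁆ M :=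
  let Φ := LinearEquiv.ofBijective _ h.bijective
  { affine i ξ ∘ₗ Φ.symm.toLinearMap with
    map_lie' := by
      intro l m
      obtain ⟨p, rfl⟩ := Φ.surjective l
      obtain ⟨q, rfl⟩ := Φ.surjective m
      change affine i ξ (Φ.symm ⁅affine j ζ p, affine j ζ q⁆) =
        ⁅affine i ξ (Φ.symm (Φ p)), affine i ξ (Φ.symm (Φ q))⁆
      rw [lie_affine h.lie_eq, Φ.symm_apply_apply, Φ.symm_apply_apply, lie_affine hξ]
      exact congrArg (affine i ξ) (Φ.symm_apply_apply _) }

variable {i : g →ₗ⁅k⁆ M} {ξ : M} (hξ : ∀ u, ⁅ξ, i u⁆ = affine i ξ (d u, χ u))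

theorem lift_affine (p : g × k) : h.lift hξ (affine j ζ p) = affine i ξ p :=
  congrArg (affine i ξ) ((LinearEquiv.ofBijective _ h.bijective).symm_apply_apply p)

end IsCodimOneExtension

end Affine

section AffineOre

variable {k : Type u} [Field k] {g : Type v} [LieRing g] [LieAlgebra k g]

local notation "U" => UniversalEnvelopingAlgebra k g
local notation "ιU" => UniversalEnvelopingAlgebra.ι k

theorem exists_twistedDerivation {τ : U →ₐ[k] U} (d : g →ₗ[k] U)
    (hd : ∀ u v : g, d ⁅u, v⁆ =
      τ (ιU u) * d v + d u * ιU v - (τ (ιU v) * d u + d v * (ιU u : U))) :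
    ∃ δ : U →ₗ[k] U, (∀ a b, δ (a * b) = τ a * δ b + δ a * b) ∧ ∀ u, δ (ιU u) = d u := by
  -- The `τ`-derivations `δ` are the upper right entries of the algebra maps `[[τ, δ], [0, id]]`.
  let f : g →ₗ⁅k⁆ Matrix (Fin 2) (Fin 2) U :=
    { toFun := fun u => !![τ (ιU u), d u; 0, ιU u]
      map_add' := fun u v => by ext i j; fin_cases i <;> fin_cases j <;> simp
      map_smul' := fun r u => by ext i j; fin_cases i <;> fin_cases j <;> simp
      map_lie' := fun {u v} => by
        rw [LieRing.of_associative_ring_bracket, hd]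
        ext i j
        fin_cases i <;> fin_cases j <;> simp [LieRing.of_associative_ring_bracket] }
  let F := UniversalEnvelopingAlgebra.lift k f
  have hF (u : g) : F (ιU u) = !![τ (ιU u), d u; 0, ιU u] :=
    UniversalEnvelopingAlgebra.lift_ι_apply k f u
  let S : Subalgebra k U :=
    { carrier := {w | F w 0 0 = τ w ∧ F w 1 0 = 0 ∧ F w 1 1 = w}
      mul_mem' := by
        rintro p q ⟨hp, hp', hp''⟩ ⟨hq, hq', hq''⟩
        simp [Matrix.mul_apply, Fin.sum_univ_two, hp, hp', hp'', hq, hq', hq'']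
      add_mem' := by
        rintro p q ⟨hp, hp', hp''⟩ ⟨hq, hq', hq''⟩
        simp [hp, hp', hp'', hq, hq', hq'']
      algebraMap_mem' := fun r => by simp [Matrix.algebraMap_matrix_apply] }
  have hS (w : U) : w ∈ S := UEAHopf.mem_of_forall_ι S (fun u => by
    change F (ιU u) 0 0 = τ (ιU u) ∧ F (ιU u) 1 0 = 0 ∧ F (ιU u) 1 1 = ιU u
    rw [hF]
    simp) w
  refine ⟨{ toFun := fun w => F w 0 1, map_add' := by simp, map_smul' := by simp },
    fun a b => ?_, fun u => ?_⟩
  · change F (a * b) 0 1 = τ a * F b 0 1 + F a 0 1 * b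
    rw [map_mul, Matrix.mul_apply, Fin.sum_univ_two, (hS a).1, (hS b).2.2]
  · change F (ιU u) 0 1 = d u
    rw [hF]
    simp

/-- The algebra map `U(g) → U(L)` induced by a Lie algebra map. -/
def mapEnveloping {L : Type t} [LieRing L] [LieAlgebra k L] (j : g →ₗ⁅k⁆ L) :
    U →ₐ[k] UniversalEnvelopingAlgebra k L :=
  UniversalEnvelopingAlgebra.lift k ((UniversalEnvelopingAlgebra.ι k).comp j)

theorem mapEnveloping_ι {L : Type t} [LieRing L] [LieAlgebra k L] (j : g →ₗ⁅k⁆ L) (u : g) :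
    mapEnveloping j (ιU u) = UniversalEnvelopingAlgebra.ι k (j u) :=
  UniversalEnvelopingAlgebra.lift_ι_apply _ _ _

/-- `δ` is a `τ`-derivation of `U(g)` with `τ(u) = u + χ(u)` and `δ(u) = d(u)` for `u` in `g`. -/
structure IsAffineDerivation (τ : U →ₐ[k] U) (δ : U →ₗ[k] U) (d : g → g) (χ : g → k) : Prop where
  δ_mul : ∀ a b, δ (a * b) = τ a * δ b + δ a * b
  τ_ι : ∀ u, τ (ιU u) = ιU u + χ u • 1
  δ_ι : ∀ u, δ (ιU u) = ιU (d u)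

theorem IsCodimOneExtension.exists_isAffineDerivation {L : Type t} [LieRing L] [LieAlgebra k L]
    {j : g →ₗ⁅k⁆ L} {ζ : L} {d : g →ₗ[k] g} {χ : g →ₗ[k] k} (h : IsCodimOneExtension j ζ d χ) :
    ∃ (τ : U →ₐ[k] U) (δ : U →ₗ[k] U), IsAffineDerivation τ δ d χ := by
  let f : g →ₗ⁅k⁆ U :=
    { (UniversalEnvelopingAlgebra.ι k : g →ₗ⁅k⁆ U).toLinearMap + χ.smulRight (1 : U) with
      map_lie' := fun {u v} => by
        change ιU ⁅u, v⁆ + χ ⁅u, v⁆ • (1 : U) = ⁅ιU u + χ u • (1 : U), ιU v + χ v • (1 : U)⁆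
        rw [(h.map_lie u v).2, LieHom.map_lie]
        simp only [LieRing.of_associative_ring_bracket, zero_smul, add_zero, add_mul, mul_add,
          smul_mul_assoc, mul_smul_comm, one_mul, mul_one]
        module }
  have hτ (u : g) : UniversalEnvelopingAlgebra.lift k f (ιU u) = ιU u + χ u • (1 : U) :=
    UniversalEnvelopingAlgebra.lift_ι_apply k f u
  obtain ⟨δ, hδ, hd⟩ := exists_twistedDerivation (τ := UniversalEnvelopingAlgebra.lift k f)
    ((UniversalEnvelopingAlgebra.ι k : g →ₗ⁅k⁆ U).toLinearMap ∘ₗ d) (fun u v => by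
      change ιU (d ⁅u, v⁆) = _ * ιU (d v) + ιU (d u) * ιU v - (_ * ιU (d u) + ιU (d v) * ιU u)
      rw [(h.map_lie u v).1, hτ, hτ]
      simp only [map_add, map_sub, map_smul, LieHom.map_lie, LieRing.of_associative_ring_bracket,
        add_mul, smul_mul_assoc, one_mul]
      abel)
  exact ⟨_, δ, hδ, hτ, hd⟩

namespace OreExtension

variable {τ : UniversalEnvelopingAlgebra k g →ₐ[k] UniversalEnvelopingAlgebra k g}
  {δ : UniversalEnvelopingAlgebra k g →ₗ[k] UniversalEnvelopingAlgebra k g}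

theorem mul_eq_of_forall_ι (hδ : ∀ a b, δ (a * b) = τ a * δ b + δ a * b) {H : Type w} [Ring H]
    [Algebra k H] (f : U →ₐ[k] H) (ζ : H)
    (h : ∀ u : g, ζ * f (ιU u) = f (τ (ιU u)) * ζ + f (δ (ιU u))) (a : U) :
    ζ * f a = f (τ a) * ζ + f (δ a) := by
  let S : Subalgebra k U :=
    { carrier := {a | ζ * f a = f (τ a) * ζ + f (δ a)}
      mul_mem' := by
        intro p q hp hq
        rw [Set.mem_ofPred_eq] at hp hq ⊢
        rw [map_mul f, ← mul_assoc, hp, add_mul, mul_assoc, hq, map_mul τ, map_mul f, hδ,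
          map_add f, map_mul f, map_mul f, mul_add, ← mul_assoc, add_assoc]
      add_mem' := by
        intro p q hp hq
        rw [Set.mem_ofPred_eq] at hp hq ⊢
        simp only [map_add, mul_add, add_mul, hp, hq, add_add_add_comm]
      algebraMap_mem' := by
        intro c
        have hc : δ (algebraMap k U c) = 0 := by
          rw [Algebra.algebraMap_eq_smul_one, map_smul, show δ 1 = 0 by simpa using hδ 1 1,
            smul_zero]
        rw [Set.mem_ofPred_eq, hc, map_zero, add_zero, AlgHom.commutes τ, AlgHom.commutes f,
          Algebra.commutes] }
  exact UEAHopf.mem_of_forall_ι S h a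

variable (τ δ) in
/-- The Lie algebra map `g → U(g)[z; τ, δ]`. -/
def ofLie : g →ₗ⁅k⁆ OreExtension τ δ :=
  (of τ δ : U →ₗ⁅k⁆ OreExtension τ δ).comp (UniversalEnvelopingAlgebra.ι k)

variable {d : g → g} {χ : g → k}

theorem injective_affine_ofLie (hδ : ∀ a b, δ (a * b) = τ a * δ b + δ a * b)
    (hι : Function.Injective (UniversalEnvelopingAlgebra.ι k : g → U)) :
    Function.Injective (affine (ofLie τ δ) (z τ δ)) := by
  refine (injective_iff_map_eq_zero _).mpr fun p hp => ?_
  have h : trunc hδ (of τ δ (ιU p.1) + p.2 • (of τ δ 1 * z τ δ)) = 0 := by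
    rw [map_one, one_mul]
    exact (congrArg (trunc hδ) hp).trans (map_zero _)
  rw [map_add, map_smul, trunc_of, trunc_of_mul_z] at h
  have h₁ : (ιU p.1 : U) = 0 := by simpa using congrArg Prod.fst h
  have h₂ : p.2 • (1 : U) = 0 := by simpa using congrArg Prod.snd h
  refine Prod.ext (hι (h₁.trans (map_zero _).symm)) ?_
  simpa using congrArg (Coalgebra.counit (R := k)) h₂

variable (h : IsAffineDerivation τ δ d χ)

include h

theorem lie_z_ofLie (u : g) :
    ⁅z τ δ, ofLie τ δ u⁆ = affine (ofLie τ δ) (z τ δ) (d u, χ u) := by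
  change z τ δ * of τ δ (ιU u) - of τ δ (ιU u) * z τ δ = of τ δ (ιU (d u)) + χ u • z τ δ
  rw [z_mul_of, h.τ_ι, h.δ_ι, map_add, map_smul, map_one, add_mul, smul_one_mul]
  abel

/-- The Lie subalgebra of the Ore extension spanned by `g` and `z`. -/
def affineSubalgebra : LieSubalgebra k (OreExtension τ δ) :=
  { LinearMap.range (affine (ofLie τ δ) (z τ δ)) with
    lie_mem' := by
      rintro _ _ ⟨p, rfl⟩ ⟨q, rfl⟩
      exact ⟨_, (lie_affine (lie_z_ofLie h) p q).symm⟩ }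

theorem exists_isCodimOneExtension_affineSubalgebra
    (hι : Function.Injective (UniversalEnvelopingAlgebra.ι k : g → U)) :
    ∃ (j : g →ₗ⁅k⁆ affineSubalgebra h) (ζ : affineSubalgebra h), IsCodimOneExtension j ζ d χ := by
  have hmem (p : g × k) : affine (ofLie τ δ) (z τ δ) p ∈ affineSubalgebra h := ⟨p, rfl⟩
  have hof (u : g) : ofLie τ δ u ∈ affineSubalgebra h := by
    simpa [affine_apply] using hmem (u, 0)
  have hz : z τ δ ∈ affineSubalgebra h := by simpa [affine_apply] using hmem (0, 1)
  let j : g →ₗ⁅k⁆ affineSubalgebra h :=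
    { toFun := fun u => ⟨ofLie τ δ u, hof u⟩
      map_add' := fun u v => Subtype.ext (map_add _ u v)
      map_smul' := fun r u => Subtype.ext (map_smul _ r u)
      map_lie' := fun {u v} => Subtype.ext (LieHom.map_lie _ u v) }
  refine ⟨j, ⟨z τ δ, hz⟩, fun u => Subtype.ext (lie_z_ofLie h u), fun p q hpq => ?_, ?_⟩
  · exact injective_affine_ofLie h.δ_mul hι (congrArg Subtype.val hpq)
  · rintro ⟨_, p, rfl⟩
    exact ⟨p, rfl⟩

variable {L : Type t} [LieRing L] [LieAlgebra k L] {j : g →ₗ⁅k⁆ L} {ζ : L}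
  (hL : IsCodimOneExtension j ζ d χ)

include hL

theorem ι_mul_mapEnveloping (a : U) : UniversalEnvelopingAlgebra.ι k ζ * mapEnveloping j a =
    mapEnveloping j (τ a) * UniversalEnvelopingAlgebra.ι k ζ + mapEnveloping j (δ a) := by
  refine mul_eq_of_forall_ι h.δ_mul _ _ (fun u => ?_) a
  have hlie := congrArg (UniversalEnvelopingAlgebra.ι k) (hL.lie_eq u)
  rw [LieHom.map_lie, LieRing.of_associative_ring_bracket, sub_eq_iff_eq_add, affine_apply,
    map_add, map_smul] at hlie
  rw [h.τ_ι, h.δ_ι, map_add, map_smul, map_one, mapEnveloping_ι, mapEnveloping_ι, hlie, add_mul,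
    smul_one_mul]
  abel

/-- The isomorphism `U(g)[z; τ, δ] → U(L)` that extends `j` and takes `z` to `ζ`. -/
def equivEnveloping : OreExtension τ δ ≃ₐ[k] UniversalEnvelopingAlgebra k L :=
  have hlift := hL.lift_affine (lie_z_ofLie h)
  AlgEquiv.ofAlgHom
    (OreExtension.lift (mapEnveloping j) (UniversalEnvelopingAlgebra.ι k ζ)
      (ι_mul_mapEnveloping h hL))
    (UniversalEnvelopingAlgebra.lift k (hL.lift (lie_z_ofLie h)))
    (UEAHopf.algHom_ext fun l => by
      obtain ⟨p, rfl⟩ := hL.bijective.surjective l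
      rw [AlgHom.comp_apply, UniversalEnvelopingAlgebra.lift_ι_apply, hlift, affine_apply,
        affine_apply, map_add, map_smul, lift_z, map_add, map_smul]
      exact congrArg (· + p.2 • UniversalEnvelopingAlgebra.ι k ζ)
        ((lift_of _ _ _ _).trans (mapEnveloping_ι j p.1)))
    (hom_ext
      (fun a => by
        rw [AlgHom.comp_apply, lift_of]
        refine DFunLike.congr_fun
          (f := (UniversalEnvelopingAlgebra.lift k (hL.lift (lie_z_ofLie h))).comp
            (mapEnveloping j))
          (g := of τ δ) (UEAHopf.algHom_ext fun u => ?_) a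
        rw [AlgHom.comp_apply, mapEnveloping_ι, UniversalEnvelopingAlgebra.lift_ι_apply]
        exact (show hL.lift (lie_z_ofLie h) (j u) = ofLie τ δ u by
          simpa [affine_apply] using hlift (u, 0)))
      (by
        rw [AlgHom.comp_apply, lift_z, UniversalEnvelopingAlgebra.lift_ι_apply]
        simpa [affine_apply] using hlift (0, 1)))

theorem equivEnveloping_of (u : g) : equivEnveloping h hL (of τ δ (ιU u)) =
    UniversalEnvelopingAlgebra.ι k (j u) :=
  (lift_of _ _ _ _).trans (mapEnveloping_ι j u)

theorem equivEnveloping_z : equivEnveloping h hL (z τ δ) = UniversalEnvelopingAlgebra.ι k ζ :=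
  lift_z _ _ _

end OreExtension

end AffineOre

namespace GeneralizedHopfOreExtension

variable {k : Type u} [Field k] {g : Type v} [LieRing g] [LieAlgebra k g]
  {L : Type t} [LieRing L] [LieAlgebra k L] {j : g →ₗ⁅k⁆ L} {ζ : L} {d : g → g} {χ : g → k}

local notation "U" => UniversalEnvelopingAlgebra k g
local notation "ιU" => UniversalEnvelopingAlgebra.ι k

/-- The enveloping algebra of a Lie algebra `L = j(g) ⊕ k ζ` as a generalized Hopf-Ore extension
of `U(g)` with variable `ζ`. -/
def ofLieExtension {τ : U →ₐ[k] U} {δ : U →ₗ[k] U} (h : IsAffineDerivation τ δ d χ)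
    (hL : IsCodimOneExtension j ζ d χ) :
    GeneralizedHopfOreExtension.{u, max u v, max u t} k (UniversalEnvelopingAlgebra k g) :=
  have hf (u : g) : IsSkewPrimitive k 1 1
      (((OreExtension.equivEnveloping h hL).toAlgHom.comp (OreExtension.of τ δ)) (ιU u)) := by
    change IsSkewPrimitive k 1 1 (OreExtension.equivEnveloping h hL (OreExtension.of τ δ (ιU u)))
    rw [OreExtension.equivEnveloping_of]
    exact isSkewPrimitive_ι _
  { τ := τ
    δ := δ
    δ_mul := h.δ_mul
    carrier := UniversalEnvelopingAlgebra k L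
    e := OreExtension.equivEnveloping h hL
    r₁ := 1
    r₂ := 1
    x := 0
    y := 0
    counit_of := DFunLike.congr_fun (counitAlgHom_comp_of_isSkewPrimitive hf)
    comul_of := fun a => (DFunLike.congr_fun (map_comp_comulAlgHom_of_isSkewPrimitive hf) a).symm
    comul_z := by
      rw [OreExtension.equivEnveloping_z, map_zero, map_zero, map_one, map_one,
        TensorProduct.zero_tmul, add_zero]
      exact isSkewPrimitive_ι _ }

theorem isNormalized_ofLieExtension {τ : U →ₐ[k] U} {δ : U →ₗ[k] U}
    (h : IsAffineDerivation τ δ d χ) (hL : IsCodimOneExtension j ζ d χ) :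
    (ofLieExtension h hL).IsNormalized where
  groupLike₁ := .one
  groupLike₂ := .one
  primitive_x := by simp [IsSkewPrimitive, ofLieExtension]
  primitive_y := by simp [IsSkewPrimitive, ofLieExtension]
  x_eq_zero_iff := Iff.rfl

variable {E : GeneralizedHopfOreExtension.{u, max u v, w} k (UniversalEnvelopingAlgebra k g)}

theorem isEnvelopingOf (h₁ : E.r₁ = 1) (h₂ : E.r₂ = 1) (hx : E.x = 0)
    (h : IsAffineDerivation E.τ E.δ d χ) (hL : IsCodimOneExtension j ζ d χ) :
    HopfOreChar2.IsEnvelopingOf E j := by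
  let Φ := (OreExtension.equivEnveloping h hL).symm.trans E.e
  have hΦι (u : g) : Φ (UniversalEnvelopingAlgebra.ι k (j u)) = E.incl (ιU u) := by
    rw [← OreExtension.equivEnveloping_of h hL]
    exact congrArg E.e (AlgEquiv.symm_apply_apply _ _)
  have hΦζ : Φ (UniversalEnvelopingAlgebra.ι k ζ) = E.var := by
    rw [← OreExtension.equivEnveloping_z h hL]
    exact congrArg E.e (AlgEquiv.symm_apply_apply _ _)
  have hincl (u : g) : IsSkewPrimitive k 1 1 (E.incl (ιU u)) := by
    rw [IsSkewPrimitive, E.comul_incl, isSkewPrimitive_ι u]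
    simp
  have hvar : IsSkewPrimitive k 1 1 E.var := by
    rw [IsSkewPrimitive, E.comul_var, h₁, h₂, hx, map_zero, TensorProduct.zero_tmul, add_zero,
      map_one]
  have hΦ (l : L) : IsSkewPrimitive k 1 1 (Φ (UniversalEnvelopingAlgebra.ι k l)) := by
    obtain ⟨p, rfl⟩ := hL.bijective.surjective l
    rw [affine_apply, map_add, map_add, map_smul, map_smul, hΦι, hΦζ]
    exact (hincl _).add (hvar.smul _)
  refine ⟨(bialgEquivOfIsSkewPrimitive Φ hΦ).symm, fun u => ?_⟩
  rw [← hΦι]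
  exact (bialgEquivOfIsSkewPrimitive Φ hΦ).toEquiv.symm_apply_apply _

end GeneralizedHopfOreExtension

namespace TwoDimEnveloping

open HopfOreChar2 OreExtension

variable {k : Type u} [Field k] {g : Type v} [LieRing g] [LieAlgebra k g]
  {B : Module.Basis (Fin 2) k g} {c : k} (hB : ⁅B 0, B 1⁆ = c • B 0)

include hB

theorem exists_isEnvelopingOf
    (E : GeneralizedHopfOreExtension.{u, max u v, w} k (UniversalEnvelopingAlgebra k g))
    (hx : E.x = 0) (hE : PreservesLie E) :
    ∃ (L : Type (max u v)) (_ : LieRing L) (_ : LieAlgebra k L) (j : g →ₗ⁅k⁆ L),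
      Module.finrank k L = 3 ∧ Function.Injective j ∧ IsEnvelopingOf E j := by
  have h₁ := r₁_eq_one hB (E := E)
  have h₂ := r₂_eq_one hB (E := E)
  have : Module.Finite k g := Module.Finite.of_basis B
  choose d hd using hE
  have h : IsAffineDerivation E.τ E.δ d fun u => E.character (UniversalEnvelopingAlgebra.ι k u) :=
    ⟨E.δ_mul, fun u => E.τ_of_isSkewPrimitive h₁ (isSkewPrimitive_ι u), hd⟩
  obtain ⟨j, ζ, hL⟩ := exists_isCodimOneExtension_affineSubalgebra h (ι_injective hB)
  refine ⟨affineSubalgebra h, inferInstance, inferInstance, j, ?_, hL.injective,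
    E.isEnvelopingOf h₁ h₂ hx h hL⟩
  rw [hL.finrank_eq, Module.finrank_eq_card_basis B, Fintype.card_fin]

theorem exists_familyA_isEnvelopingOf [CharP k 2] {L : Type t} [LieRing L] [LieAlgebra k L]
    (j : g →ₗ⁅k⁆ L) (hL : Module.finrank k L = 3) (hj : Function.Injective j) :
    ∃ E : GeneralizedHopfOreExtension.{u, max u v, max u v} k (UniversalEnvelopingAlgebra k g),
      FamilyA (B 0) (B 1) E ∧ PreservesLie E ∧ IsEnvelopingOf E j := by
  obtain ⟨ζ, d, χ, hζ⟩ := exists_isCodimOneExtension hj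
    (hL.trans (by rw [Module.finrank_eq_card_basis B, Fintype.card_fin]))
  obtain ⟨τ, δ, h⟩ := hζ.exists_isAffineDerivation
  -- `U(L)` lies in the wrong universe; the Lie subalgebra spanned by `g` and `z` replaces `L`.
  obtain ⟨i, ξ, hξ⟩ := exists_isCodimOneExtension_affineSubalgebra h (ι_injective hB)
  have hE := GeneralizedHopfOreExtension.isNormalized_ofLieExtension h hξ
  exact ⟨_, familyA_of_eq_zero hB hE rfl, fun u => ⟨_, h.δ_ι u⟩,
    GeneralizedHopfOreExtension.isEnvelopingOf rfl rfl rfl h hζ⟩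

end TwoDimEnveloping

end

theorem proposition2p14 {k : Type u} [Field k] [CharP k 2]
    {g : Type v} [LieRing g] [LieAlgebra k g] (hg : Module.finrank k g = 2) :
    (∀ E : GeneralizedHopfOreExtension.{u, max u v, w} k (UniversalEnvelopingAlgebra k g),
      E.r₁ = 1 ∧ E.r₂ = 1 ∧
        (E.IsNormalized → E.x ∈ restrictedHull k g 2 ∧ E.y ∈ restrictedHull k g 2)) ∧
    (∃ B : Module.Basis (Fin 2) k g, ⁅B 0, B 1⁆ = 0 ∨ ⁅B 0, B 1⁆ = B 0) ∧
    (∀ B : Module.Basis (Fin 2) k g, (⁅B 0, B 1⁆ = 0 ∨ ⁅B 0, B 1⁆ = B 0) →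
      (∀ E : GeneralizedHopfOreExtension.{u, max u v, w} k (UniversalEnvelopingAlgebra k g),
        ∃ E' : GeneralizedHopfOreExtension.{u, max u v, w} k (UniversalEnvelopingAlgebra k g),
          E.Isomorphic E' ∧
            (HopfOreChar2.FamilyA (B 0) (B 1) E' ∨ HopfOreChar2.FamilyB (B 0) (B 1) E' ∨
              HopfOreChar2.FamilyC (B 0) (B 1) E' ∨ HopfOreChar2.FamilyD (B 0) (B 1) E')) ∧
      (∀ E : GeneralizedHopfOreExtension.{u, max u v, w} k (UniversalEnvelopingAlgebra k g),
        HopfOreChar2.FamilyA (B 0) (B 1) E → HopfOreChar2.PreservesLie E →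
          ∃ (L : Type (max u v)) (_ : LieRing L) (_ : LieAlgebra k L) (j : g →ₗ⁅k⁆ L),
            Module.finrank k L = 3 ∧ Function.Injective j ∧ HopfOreChar2.IsEnvelopingOf E j) ∧
      (∀ (L : Type t) [LieRing L] [LieAlgebra k L] (j : g →ₗ⁅k⁆ L),
        Module.finrank k L = 3 → Function.Injective j →
          ∃ E : GeneralizedHopfOreExtension.{u, max u v, max u v} k
              (UniversalEnvelopingAlgebra k g),
            HopfOreChar2.FamilyA (B 0) (B 1) E ∧ HopfOreChar2.PreservesLie E ∧
              HopfOreChar2.IsEnvelopingOf E j)) := by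
  obtain ⟨B₀, hB₀⟩ := TwoDimEnveloping.exists_basis_lie_eq hg
  obtain ⟨c₀, hc₀⟩ := TwoDimEnveloping.exists_lie_eq_smul hB₀
  refine ⟨fun E => ⟨TwoDimEnveloping.r₁_eq_one hc₀, TwoDimEnveloping.r₂_eq_one hc₀, fun hE => ?_⟩,
    ⟨B₀, hB₀⟩, fun B hB => ?_⟩
  · exact ⟨TwoDimEnveloping.mem_restrictedHull_of_isSkewPrimitive hc₀ 2 Nat.prime_two
        (TwoDimEnveloping.isSkewPrimitive_x hc₀ hE),
      TwoDimEnveloping.mem_restrictedHull_of_isSkewPrimitive hc₀ 2 Nat.prime_two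
        (TwoDimEnveloping.isSkewPrimitive_y hc₀ hE)⟩
  obtain ⟨c, hc⟩ := TwoDimEnveloping.exists_lie_eq_smul hB
  refine ⟨fun E => ?_, fun E hA hE => ?_, fun L _ _ j hL hj => ?_⟩
  · obtain ⟨E', hiso, hE'⟩ := E.exists_isomorphic_isNormalized fun w hw =>
      TwoDimEnveloping.eq_one_of_isGroupLikeElem hc hw
    exact ⟨E', hiso, TwoDimEnveloping.mem_family_of_isNormalized hE' hB⟩
  · obtain ⟨χ, hform, -⟩ := hA
    exact TwoDimEnveloping.exists_isEnvelopingOf hc E hform.x_eq hE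
  · exact TwoDimEnveloping.exists_familyA_isEnvelopingOf hc j hL hj
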